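/- Let $n\ge 0$ and let $P$ be a poset on $\{1,2,\ldots,n\}$ with order $\le_P$ which is naturally labeled, i.e. $i<j$ whenever $i<_P j$. A linear extension of $P$ is a permutation $w=w_1w_2\cdots w_n$ of $\{1,\ldots,n\}$ such that $i<j$ whenever $w_i<_P w_j$; $\mathcal L(P)$ is the set of these, and $\mathrm{maj}(w)=\sum_{1\le i\le n-1,\ w_i>w_{i+1}} i$. A connected order ideal of $P$ is a nonempty down-closed subset $J$ of $P$ whose Hasse diagram is a connected graph. Let $G_P$ be the graph whose vertices are the connected order ideals of $P$, two of them being adjacent if they have nonempty intersection and neither contains the other. Let $C_1,\ldots,C_h$ be the connected components of $G_P$, with vertex sets $V(C_r)$. For a graph $G$, let $\mathscr M(G)$ be the set of its maximum independent sets, i.e. its independent sets of largest possible size. For $M\in\mathscr M(G_P)$ and $J\in M$ put $\mu(M,J)=\bigcup_{J'\in M,\ J'\subsetneq J}J'$. Let $F_M$ be the partial order on $\{1,\ldots,n\}$ in which $i<_{F_M}j$ if and only if there are $J_a,J_b\in M$ with $J_a\setminus\mu(M,J_a)=\{i\}$, $J_b\setminus\mu(M,J_b)=\{j\}$ and $J_a\subsetneq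 J_b$, and let $$\mathrm{Des}(M)=\{\,i \mid i \text{ is covered in } F_M \text{ by some } j \text{ with } i>j\,\}.$$ For $M_r\in\mathscr M(C_r)$ and $M\in\mathscr M(G_P)$ with $M\cap V(C_r)=M_r$ let $$\mathrm{Des}(M_r,M)=\{\,i\in\mathrm{Des}(M)\mid \{i\}=J\setminus\mu(M,J)\text{ for some }J\in M_r\,\},$$ $$\overline{\mathrm{Des}}(M_r,M)=\{\,J\in M_r\mid J\setminus\mu(M,J)=\{i\}\text{ for some } i\in\mathrm{Des}(M_r,M)\,\}.$$ Then for every $r$ and every $M_r\in\mathscr M(C_r)$ there is an $M\in\mathscr M(G_P)$ with $M\cap V(C_r)=M_r$, and $\overline{\mathrm{Des}}(M_r,M)$ does not depend on the choice of such an $M$, so that it may be denoted by $\overline{\mathrm{Des}}(M_r)$. Moreover, with $[i]_q=1-q^i$ and $[m]!_q=\prod_{i=1}^m[i]_q$, the following identity of rational functions in the indeterminate $q$ (over $\mathbb Q$) holds: $$\sum_{w\in\mathcal L(P)}q^{\mathrm{maj}(w)}=[n]!_q\prod_{r=1}^h\ \sum_{M_r\in\mathscr M(C_r)}\frac{q^{\sum_{J\in\overline{\mathrm{Des}}(M_r)}|J|}}{\prod_{J\in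 M_r}[|J|]_q}.$$ -/

import Mathlib

/-!  A poset `P` on `{1, …, n}` is a term `P : PartialOrder (Fin n)`, the element `i : Fin n`
standing for `i + 1`. The order of `P` is always written `P.le`, `P.lt`; the natural order of the
labels is always the order of natural numbers `(i : ℕ) < (j : ℕ)`. -/

namespace ConnectedOrderIdeals

open Finset

/-- `P` is naturally labeled: `i <_P j` implies `i < j`. -/
def NaturallyLabeled {n : ℕ} (P : PartialOrder (Fin n)) : Prop :=
  ∀ i j : Fin n, P.lt i j → (i : ℕ) < (j : ℕ)

/-- The permutation `w = w_1 ⋯ w_n` is a linear extension of `P`: whenever `w_i <_P w_j`, `i < j`. -/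
def IsLinearExtension {n : ℕ} (P : PartialOrder (Fin n)) (w : Equiv.Perm (Fin n)) : Prop :=
  ∀ i j : Fin n, P.lt (w i) (w j) → (i : ℕ) < (j : ℕ)

open Classical in
/-- The set `L(P)` of linear extensions of `P`. -/
noncomputable def linearExtensions {n : ℕ} (P : PartialOrder (Fin n)) :
    Finset (Equiv.Perm (Fin n)) :=
  univ.filter (IsLinearExtension P)

/-- The descent set of a permutation: the positions `k` with `1 ≤ k ≤ n - 1` and `w_k > w_{k+1}`
(positions counted from 1, so that `w_k` is the value of `w` at `k - 1 : Fin n`). -/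
def permDes {n : ℕ} (w : Equiv.Perm (Fin n)) : Finset ℕ :=
  (Finset.Icc 1 (n - 1)).filter fun k =>
    ∃ i j : Fin n, (i : ℕ) + 1 = k ∧ (j : ℕ) = k ∧ (w j : ℕ) < (w i : ℕ)

/-- The major index of a permutation. -/
def maj {n : ℕ} (w : Equiv.Perm (Fin n)) : ℕ := ∑ k ∈ permDes w, k

/-- `J` is a connected order ideal of `P`: a down-closed set whose Hasse diagram is a connected
(in particular nonempty) graph. As `J` is down-closed, the Hasse diagram of `J` is the Hasse
diagram of `P` restricted to `J`. -/
def IsConnIdeal {n : ℕ} (P : PartialOrder (Fin n)) (J : Finset (Fin n)) : Prop :=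
  (∀ i ∈ J, ∀ j, P.le j i → j ∈ J) ∧
    ((@SimpleGraph.hasse (Fin n) P.toPreorder).induce (J : Set (Fin n))).Connected

/-- The set of connected order ideals of `P`. -/
abbrev ConnIdeal {n : ℕ} (P : PartialOrder (Fin n)) : Type :=
  {J : Finset (Fin n) // IsConnIdeal P J}

/-- The graph `G_P`: its vertices are the connected order ideals of `P`, and two of them are
adjacent if they intersect and neither contains the other. -/
def idealGraph {n : ℕ} (P : PartialOrder (Fin n)) : SimpleGraph (ConnIdeal P) where
  Adj J K := (J.1 ∩ K.1).Nonempty ∧ ¬ J.1 ⊆ K.1 ∧ ¬ K.1 ⊆ J.1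
  symm := ⟨fun J K h => ⟨by rw [Finset.inter_comm]; exact h.1, h.2.2, h.2.1⟩⟩
  loopless := ⟨fun _ h => h.2.1 (Finset.Subset.refl _)⟩

open Classical in
noncomputable instance {n : ℕ} (P : PartialOrder (Fin n)) :
    Fintype (idealGraph P).ConnectedComponent := Fintype.ofFinite _

/-- The set `𝓜(G_P)` of maximum independent sets of `G_P`. -/
abbrev MaxIndep {n : ℕ} (P : PartialOrder (Fin n)) : Type :=
  {M : Finset (ConnIdeal P) // (idealGraph P).IsMaximumIndepSet M}

open Classical in
/-- The set `𝓜(C)` of maximum independent sets of the connected component `C` of `G_P`, each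
regarded as a set of vertices of `G_P`. -/
noncomputable def compMaxIndep {n : ℕ} {P : PartialOrder (Fin n)}
    (C : (idealGraph P).ConnectedComponent) : Finset (Finset (ConnIdeal P)) :=
  (univ.filter fun S : Finset C => C.toSimpleGraph.IsMaximumIndepSet S).image
    fun S => S.map (Function.Embedding.subtype _)

open Classical in
/-- `μ(M, J)`, the union of all `J' ∈ M` with `J' ⊊ J`. -/
noncomputable def mu {n : ℕ} {P : PartialOrder (Fin n)}
    (M : Finset (ConnIdeal P)) (J : ConnIdeal P) : Finset (Fin n) :=
  (M.filter fun J' => J'.1 ⊂ J.1).biUnion fun J' => J'.1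

/-- The relation `i <_{F_M} j`: there are `J_a, J_b ∈ M` with `J_a \ μ(M, J_a) = {i}`,
`J_b \ μ(M, J_b) = {j}` and `J_a ⊊ J_b`. -/
def forestLT {n : ℕ} {P : PartialOrder (Fin n)} (M : Finset (ConnIdeal P)) (i j : Fin n) : Prop :=
  ∃ Ja ∈ M, ∃ Jb ∈ M, Ja.1 \ mu M Ja = {i} ∧ Jb.1 \ mu M Jb = {j} ∧ Ja.1 ⊂ Jb.1

theorem mem_and_notMem_of_sdiff {n : ℕ} {A B : Finset (Fin n)} {i : Fin n} (h : A \ B = {i}) :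
    i ∈ A ∧ i ∉ B := by
  have : i ∈ A \ B := by rw [h]; exact Finset.mem_singleton_self i
  exact Finset.mem_sdiff.1 this

theorem subset_mu {n : ℕ} {P : PartialOrder (Fin n)} {M : Finset (ConnIdeal P)}
    {J K : ConnIdeal P} (hJ : J ∈ M) (h : J.1 ⊂ K.1) : J.1 ⊆ mu M K := by
  classical
  intro x hx
  unfold mu
  exact Finset.mem_biUnion.2 ⟨J, Finset.mem_filter.2 ⟨hJ, h⟩, hx⟩

theorem forestLT_irrefl {n : ℕ} {P : PartialOrder (Fin n)} (M : Finset (ConnIdeal P))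
    (i : Fin n) : ¬ forestLT M i i := by
  rintro ⟨Ja, ha, Jb, -, h1, h2, h3⟩
  exact (mem_and_notMem_of_sdiff h2).2 (subset_mu ha h3 (mem_and_notMem_of_sdiff h1).1)

theorem forestLT_trans {n : ℕ} {P : PartialOrder (Fin n)} {M : Finset (ConnIdeal P)}
    (hM : (idealGraph P).IsIndepSet (M : Set (ConnIdeal P))) {i j k : Fin n}
    (hij : forestLT M i j) (hjk : forestLT M j k) : forestLT M i k := by
  obtain ⟨Ja, ha, Jb, hb, h1, h2, h3⟩ := hij
  obtain ⟨Jc, hc, Jd, hd, h4, h5, h6⟩ := hjk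
  have mb := mem_and_notMem_of_sdiff h2
  have mc := mem_and_notMem_of_sdiff h4
  have hbc : Jb = Jc := by
    by_contra hne
    have hna := hM (Finset.mem_coe.2 hb) (Finset.mem_coe.2 hc) hne
    have hne' : Jb.1 ≠ Jc.1 := fun h => hne (Subtype.ext h)
    by_cases h7 : Jb.1 ⊆ Jc.1
    · exact mc.2 (subset_mu hb (Finset.ssubset_iff_subset_ne.2 ⟨h7, hne'⟩) mb.1)
    · by_cases h8 : Jc.1 ⊆ Jb.1
      · exact mb.2 (subset_mu hc (Finset.ssubset_iff_subset_ne.2 ⟨h8, hne'.symm⟩) mc.1)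
      · exact hna ⟨⟨j, Finset.mem_inter.2 ⟨mb.1, mc.1⟩⟩, h7, h8⟩
  subst hbc
  exact ⟨Ja, ha, Jd, hd, h1, h5, h3.trans h6⟩

/-- The poset `F_M = Ψ(M)` on `{1, …, n}` of a maximum independent set `M` of `G_P`. -/
def forest {n : ℕ} {P : PartialOrder (Fin n)} (M : MaxIndep P) : PartialOrder (Fin n) where
  le i j := i = j ∨ forestLT M.1 i j
  lt i j := forestLT M.1 i j
  le_refl i := Or.inl rfl
  le_trans i j k hij hjk := by
    rcases hij with rfl | hij
    · exact hjk
    · rcases hjk with rfl | hjk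
      · exact Or.inr hij
      · exact Or.inr (forestLT_trans M.2.isIndepSet hij hjk)
  lt_iff_le_not_ge i j := by
    constructor
    · intro h
      refine ⟨Or.inr h, ?_⟩
      rintro (rfl | h')
      · exact forestLT_irrefl _ _ h
      · exact forestLT_irrefl _ _ (forestLT_trans M.2.isIndepSet h h')
    · rintro ⟨rfl | h, h'⟩
      · exact absurd (Or.inl rfl) h'
      · exact h
  le_antisymm i j hij hji := by
    rcases hij with rfl | hij
    · rfl
    · rcases hji with rfl | hji
      · rfl
      · exact absurd (forestLT_trans M.2.isIndepSet hij hji) (forestLT_irrefl _ _)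

/-- The descent set of a forest `F` on `{1, …, n}`: those `i` that have a parent `j` (an element
covering `i` in `F`) with `i > j`. Roots are not descents. -/
def forestDes {n : ℕ} (F : PartialOrder (Fin n)) : Set (Fin n) :=
  {i | ∃ j, @CovBy (Fin n) F.toPreorder.toLT i j ∧ (j : ℕ) < (i : ℕ)}

/-- `Des(M) = Des(F_M)`. -/
def des {n : ℕ} {P : PartialOrder (Fin n)} (M : MaxIndep P) : Set (Fin n) := forestDes (forest M)

/-- `Des(M_r, M)`. -/
def desIn {n : ℕ} {P : PartialOrder (Fin n)} (Mr : Finset (ConnIdeal P)) (M : MaxIndep P) :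
    Set (Fin n) :=
  {i | i ∈ des M ∧ ∃ J ∈ Mr, J.1 \ mu M.1 J = {i}}

open Classical in
/-- `\overline{Des}(M_r, M)`. -/
noncomputable def desBarIn {n : ℕ} {P : PartialOrder (Fin n)} (Mr : Finset (ConnIdeal P))
    (M : MaxIndep P) : Finset (ConnIdeal P) :=
  Mr.filter fun J => ∃ i ∈ desIn Mr M, J.1 \ mu M.1 J = {i}

open Classical in
/-- `\overline{Des}(M_r)` for `M_r ∈ 𝓜(C)`: the set `\overline{Des}(M_r, M)` for some
`M ∈ 𝓜(G_P)` with `M ∩ V(C) = M_r` (and `∅` if there is no such `M`). -/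
noncomputable def desBar {n : ℕ} {P : PartialOrder (Fin n)}
    (C : (idealGraph P).ConnectedComponent) (Mr : Finset (ConnIdeal P)) :
    Finset (ConnIdeal P) :=
  if h : ∃ M : MaxIndep P, (M.1 : Set (ConnIdeal P)) ∩ C.supp = (Mr : Set (ConnIdeal P)) then
    desBarIn Mr h.choose
  else ∅

/-- The indeterminate `q`, in the field of rational functions over `ℚ`. -/
noncomputable def q : RatFunc ℚ := RatFunc.X

/-- `[i]_q = 1 - q^i`. -/
noncomputable def qBracket (i : ℕ) : RatFunc ℚ := 1 - q ^ i

/-- `[m]!_q = [1]_q [2]_q ⋯ [m]_q`. -/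
noncomputable def qFactorial (m : ℕ) : RatFunc ℚ := ∏ i ∈ Finset.Icc 1 m, qBracket i

end ConnectedOrderIdeals

/-!
Give a connected order ideal `J` the weight `q^{|J|} / [|J|]_q`, and let `F(U)` be the generating
function of the independent sets of `G_P` whose members lie in `U`. The maximal members of an
independent set are the connected components of its union; collecting the independent sets by
their union therefore gives `F(U) = ∑_A q^{|A|} F(A)` over the order ideals `A ⊆ U`. The generating
function of `P`-partitions satisfies this recursion as well, and the recursion alone implies, by
removing the last letter of a linear extension, that `∑_w q^{maj(w)} = [n]!_q F({1, …, n})`.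

An independent set `N` orders the elements by decreasing number of members of `N` that contain
them, ties being broken by the labels. Inserting the elements in this order, and recording each
time the connected component of the new element, yields a maximum independent set `M ⊇ N`. The `N`
that yield a given `M` are exactly those between the set `D ⊆ M` of its descents and `M`, because at
a descent the labels would break a tie the wrong way. As `1 + q^{|J|} / [|J|]_q = 1 / [|J|]_q`,
their weights add up to `∏_{J ∈ D} q^{|J|} / ∏_{J ∈ M} [|J|]_q`.

Finally, the union of a component `C` of `G_P` is comparable with or disjoint from every connected
order ideal, so it belongs to every maximum independent set. It shields `C` from the other
components: which members of `M ∩ V(C)` are descents of `M` depends on `M ∩ V(C)` alone, and the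
sum over `M` factors.
-/

namespace ConnectedOrderIdeals

open Finset
open scoped Classical

section Hasse

variable {α : Type*} [PartialOrder α] {s : Set α}

theorem reachable_hasse_induce_of_le [LocallyFiniteOrder α] (hs : IsLowerSet s) {a b : α}
    (hab : a ≤ b) (ha : a ∈ s) (hb : b ∈ s) :
    ((SimpleGraph.hasse α).induce s).Reachable ⟨a, ha⟩ ⟨b, hb⟩ := by
  have chain := le_iff_reflTransGen_covBy.1 hab
  clear hab
  induction chain using Relation.ReflTransGen.head_induction_on with
  | refl => exact .refl _
  | @head a c hac hcb ih =>
    have hc : c ∈ s := hs (le_iff_reflTransGen_covBy.2 hcb) hb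
    have hadj : ((SimpleGraph.hasse α).induce s).Adj ⟨a, ha⟩ ⟨c, hc⟩ := Or.inl hac
    exact hadj.reachable.trans (ih hc)

theorem eq_of_hasse_induce_preconnected (hs : ((SimpleGraph.hasse α).induce s).Preconnected)
    {t : Set α} (hts : t ⊆ s) (ht : IsLowerSet t) (hst : IsLowerSet (s \ t)) (hne : t.Nonempty) :
    t = s := by
  obtain ⟨x, hx⟩ := hne
  refine hts.antisymm fun y hy => by_contra fun hyt => ?_
  obtain ⟨walk⟩ := hs ⟨x, hts hx⟩ ⟨y, hy⟩
  obtain ⟨d, -, hfst, hsnd⟩ := walk.exists_boundary_dart {z | z.1 ∈ t} hx hyt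
  rcases d.adj with hcov | hcov
  · exact (hst hcov.le ⟨d.snd.2, hsnd⟩).2 hfst
  · exact hsnd (ht hcov.le hfst)

theorem hasse_induce_connected_iff [LocallyFiniteOrder α] (hs : IsLowerSet s) :
    ((SimpleGraph.hasse α).induce s).Connected ↔
      s.Nonempty ∧ ∀ t ⊆ s, IsLowerSet t → IsLowerSet (s \ t) → t.Nonempty → t = s := by
  constructor
  · exact fun h => ⟨Set.nonempty_coe_sort.1 h.nonempty, fun t hts ht hst hne =>
      eq_of_hasse_induce_preconnected h.preconnected hts ht hst hne⟩
  · rintro ⟨⟨x, hx⟩, hmin⟩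
    let t : Set α :=
      {y | ∃ hy : y ∈ s, ((SimpleGraph.hasse α).induce s).Reachable ⟨x, hx⟩ ⟨y, hy⟩}
    have ht : IsLowerSet t := fun b a hab ⟨hb, hxb⟩ =>
      ⟨hs hab hb, hxb.trans (reachable_hasse_induce_of_le hs hab (hs hab hb) hb).symm⟩
    have hst : IsLowerSet (s \ t) := fun b a hab ⟨hb, hbt⟩ =>
      ⟨hs hab hb, fun ⟨ha, hxa⟩ =>
        hbt ⟨hb, hxa.trans (reachable_hasse_induce_of_le hs hab ha hb)⟩⟩
    have hts : t = s := hmin t (fun _ hy => hy.1) ht hst ⟨x, hx, .refl _⟩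
    exact SimpleGraph.connected_iff_exists_forall_reachable _ |>.2
      ⟨⟨x, hx⟩, fun y => (hts.ge y.2).2⟩

end Hasse

section OrderIdeals

variable {α : Type*} {P : PartialOrder α}

/-- `S` is an order ideal of `P`. The order is an explicit argument because the underlying type
usually carries another order. -/
def IsOrderIdeal (P : PartialOrder α) (S : Finset α) : Prop := @IsLowerSet α P.toLE S

theorem isOrderIdeal_empty : IsOrderIdeal P ∅ := fun _ _ _ h => absurd h (by simp)

theorem isOrderIdeal_univ [Fintype α] : IsOrderIdeal P univ := fun _ _ _ _ => by simp

variable [DecidableEq α] {A B I J K : Finset α}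

theorem IsOrderIdeal.union (hA : IsOrderIdeal P A) (hB : IsOrderIdeal P B) :
    IsOrderIdeal P (A ∪ B) := by
  rw [IsOrderIdeal, coe_union]
  exact @IsLowerSet.union α P.toLE _ _ hA hB

theorem IsOrderIdeal.inter (hA : IsOrderIdeal P A) (hB : IsOrderIdeal P B) :
    IsOrderIdeal P (A ∩ B) := by
  rw [IsOrderIdeal, coe_inter]
  exact @IsLowerSet.inter α P.toLE _ _ hA hB

/-- `J` is a union of connected components of the Hasse diagram of `I`: it is an order ideal of `P`
contained in `I` whose complement in `I` is again an order ideal. -/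
structure IsSummand (P : PartialOrder α) (J I : Finset α) : Prop where
  subset : J ⊆ I
  isOrderIdeal : IsOrderIdeal P J
  isOrderIdeal_sdiff : IsOrderIdeal P (I \ J)

theorem IsOrderIdeal.isSummand_self (hI : IsOrderIdeal P I) : IsSummand P I I :=
  ⟨Subset.rfl, hI, by rw [sdiff_self]; exact isOrderIdeal_empty⟩

namespace IsSummand

theorem trans (hJ : IsSummand P A J) (hI : IsSummand P J I) : IsSummand P A I where
  subset := hJ.subset.trans hI.subset
  isOrderIdeal := hJ.isOrderIdeal
  isOrderIdeal_sdiff := by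
    rw [← sdiff_union_sdiff_cancel hI.subset hJ.subset]
    exact hI.isOrderIdeal_sdiff.union hJ.isOrderIdeal_sdiff

theorem sdiff (h : IsSummand P J I) : IsSummand P (I \ J) I where
  subset := sdiff_subset
  isOrderIdeal := h.isOrderIdeal_sdiff
  isOrderIdeal_sdiff := by
    rw [Finset.sdiff_sdiff_eq_self h.subset]
    exact h.isOrderIdeal

theorem inter (h : IsSummand P J I) (hK : IsOrderIdeal P K) (hKI : K ⊆ I) :
    IsSummand P (K ∩ J) K where
  subset := inter_subset_left
  isOrderIdeal := hK.inter h.isOrderIdeal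
  isOrderIdeal_sdiff := by
    have : K \ (K ∩ J) = K ∩ (I \ J) := by grind
    rw [this]
    exact hK.inter h.isOrderIdeal_sdiff

end IsSummand

end OrderIdeals

section ConnectedIdeals

variable {n : ℕ} {P : PartialOrder (Fin n)} {A I J K : Finset (Fin n)} {i : Fin n}

theorem isConnIdeal_iff :
    IsConnIdeal P J ↔
      J.Nonempty ∧ IsOrderIdeal P J ∧ ∀ A, IsSummand P A J → A.Nonempty → A = J := by
  have hdown : (∀ i ∈ J, ∀ j, P.le j i → j ∈ J) ↔ IsOrderIdeal P J :=
    ⟨fun h i j hji hi => h i hi j hji, fun h i hi j hji => h hji hi⟩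
  rw [IsConnIdeal, hdown, and_left_comm]
  refine and_congr_right fun hJ => ?_
  let : @LocallyFiniteOrder (Fin n) P.toPreorder :=
    @Fintype.toLocallyFiniteOrder _ P.toPreorder _ _ _
  rw [@hasse_induce_connected_iff (Fin n) P _ _ hJ, coe_nonempty]
  refine and_congr_right fun _ => ⟨fun h A hA hne => ?_, fun h t htJ ht hJt hne => ?_⟩
  · exact coe_injective (h A (coe_subset.2 hA.subset) hA.isOrderIdeal
      (by simpa only [IsOrderIdeal, coe_sdiff] using hA.isOrderIdeal_sdiff) hne)
  · lift t to Finset (Fin n) using t.toFinite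
    exact congrArg _ (h t ⟨coe_subset.1 htJ, ht,
      by simpa only [IsOrderIdeal, coe_sdiff] using hJt⟩ hne)

theorem IsConnIdeal.nonempty (h : IsConnIdeal P J) : J.Nonempty := (isConnIdeal_iff.1 h).1

theorem IsConnIdeal.isOrderIdeal (h : IsConnIdeal P J) : IsOrderIdeal P J :=
  (isConnIdeal_iff.1 h).2.1

theorem IsConnIdeal.subset_of_isSummand (hK : IsConnIdeal P K) (hJ : IsSummand P J I)
    (hKI : K ⊆ I) (hne : (K ∩ J).Nonempty) : K ⊆ J :=
  inter_eq_left.1 ((isConnIdeal_iff.1 hK).2.2 _ (hJ.inter hK.isOrderIdeal hKI) hne)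

theorem isConnIdeal_principal (P : PartialOrder (Fin n)) (i : Fin n) :
    IsConnIdeal P (univ.filter (P.le · i)) := by
  refine isConnIdeal_iff.2 ⟨⟨i, by simp⟩, ?_, fun A hA hne => ?_⟩
  · intro a b hba ha
    simp only [coe_filter, mem_univ, true_and, Set.mem_ofPred_eq] at ha ⊢
    exact P.le_trans _ _ _ hba ha
  · refine hA.subset.antisymm fun a ha => ?_
    have hle : ∀ b ∈ univ.filter (P.le · i), P.le b i := fun b hb => (mem_filter.1 hb).2
    have hi : i ∈ A := by
      by_contra hi
      obtain ⟨b, hb⟩ := hne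
      have : b ∈ univ.filter (P.le · i) \ A :=
        hA.isOrderIdeal_sdiff (hle b (hA.subset hb)) (by simp [hi])
      exact (mem_sdiff.1 this).2 hb
    exact hA.isOrderIdeal (hle a ha) hi

theorem IsOrderIdeal.exists_isSummand_connIdeal (hI : IsOrderIdeal P I) (hi : i ∈ I) :
    ∃ J : ConnIdeal P, IsSummand P J.1 I ∧ i ∈ J.1 := by
  obtain ⟨J, ⟨hJ, hiJ⟩, hmin⟩ := exists_minimal_of_wellFoundedLT
    (fun J => IsSummand P J I ∧ i ∈ J) ⟨I, hI.isSummand_self, hi⟩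
  refine ⟨⟨J, isConnIdeal_iff.2 ⟨⟨i, hiJ⟩, hJ.isOrderIdeal, fun A hA hne => ?_⟩⟩, hJ, hiJ⟩
  by_cases hiA : i ∈ A
  · exact hA.subset.antisymm (hmin ⟨hA.trans hJ, hiA⟩ hA.subset)
  · obtain ⟨a, ha⟩ := hne
    have hJA : J ⊆ J \ A := hmin ⟨hA.sdiff.trans hJ, mem_sdiff.2 ⟨hiJ, hiA⟩⟩ sdiff_subset
    exact absurd ha (mem_sdiff.1 (hJA (hA.subset ha))).2

/-- The connected components of an order ideal `S`, each of which is a connected order ideal. -/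
noncomputable def components (P : PartialOrder (Fin n)) (S : Finset (Fin n)) :
    Finset (ConnIdeal P) :=
  univ.filter fun J => IsSummand P J.1 S

theorem mem_components {S : Finset (Fin n)} {J : ConnIdeal P} :
    J ∈ components P S ↔ IsSummand P J.1 S := by
  simp [components]

theorem pairwiseDisjoint_components (S : Finset (Fin n)) :
    (components P S : Set (ConnIdeal P)).PairwiseDisjoint Subtype.val := by
  intro J hJ K hK hne
  rw [mem_coe, mem_components] at hJ hK
  by_contra h
  obtain hJK : (J.1 ∩ K.1).Nonempty := not_disjoint_iff_nonempty_inter.1 h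
  exact hne (Subtype.ext ((J.2.subset_of_isSummand hK hJ.subset hJK).antisymm
    (K.2.subset_of_isSummand hJ hK.subset (inter_comm J.1 K.1 ▸ hJK))))

theorem IsOrderIdeal.biUnion_components (hI : IsOrderIdeal P I) :
    (components P I).biUnion Subtype.val = I := by
  refine (biUnion_subset.2 fun J hJ => (mem_components.1 hJ).subset).antisymm fun i hi => ?_
  obtain ⟨J, hJ, hiJ⟩ := hI.exists_isSummand_connIdeal hi
  exact mem_biUnion.2 ⟨J, mem_components.2 hJ, hiJ⟩

theorem IsOrderIdeal.sum_card_components (hI : IsOrderIdeal P I) :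
    ∑ J ∈ components P I, J.1.card = I.card := by
  rw [← card_biUnion (pairwiseDisjoint_components I), hI.biUnion_components]

end ConnectedIdeals

section MajorIndex

variable {β : Type*} [LT β] [DecidableLT β] {k : ℕ}

/-- The major index of a word over an ordered alphabet, with positions counted from `1`. -/
def majWord (u : Fin k → β) : ℕ :=
  ∑ p ∈ Icc 1 (k - 1) with ∃ i j : Fin k, (i : ℕ) + 1 = p ∧ (j : ℕ) = p ∧ u j < u i, p

theorem majWord_eq_zero_of_le_one (hk : k ≤ 1) (u : Fin k → β) : majWord u = 0 := by
  rw [majWord, Icc_eq_empty (by omega), filter_empty, sum_empty]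

theorem majWord_snoc (u : Fin (k + 1) → β) (a : β) :
    majWord (Fin.snoc u a : Fin (k + 2) → β) =
      majWord u + if a < u (Fin.last k) then k + 1 else 0 := by
  rw [majWord, majWord, sum_filter, sum_filter, Nat.add_sub_cancel, Nat.add_sub_cancel,
    sum_Icc_succ_top (by omega)]
  congr 1
  · refine sum_congr rfl fun p hp => if_congr ?_ rfl rfl
    obtain ⟨-, hpk⟩ := mem_Icc.1 hp
    have hj : k + 1 ≠ p := by omega
    have hi : k + 1 + 1 ≠ p := by omega
    simp [Fin.exists_fin_succ' (n := k + 1), hj, hi]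
  · refine if_congr ⟨?_, fun h => ⟨(Fin.last k).castSucc, Fin.last (k + 1), ?_⟩⟩ rfl rfl
    · rintro ⟨i, j, hi, hj, h⟩
      obtain rfl : i = (Fin.last k).castSucc := Fin.ext (by simpa using hi)
      obtain rfl : j = Fin.last (k + 1) := Fin.ext hj
      simpa using h
    · simpa using h

end MajorIndex

section LinearExtensions

variable {α : Type*} {P : PartialOrder α} {k : ℕ} {U : Finset α} {b : α}

/-- The set of maximal elements of `U` with respect to `P`. -/
noncomputable def maximals (P : PartialOrder α) (U : Finset α) : Finset α :=
  U.filter fun b => ∀ y ∈ U, ¬P.lt b y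

theorem mem_maximals : b ∈ maximals P U ↔ b ∈ U ∧ ∀ y ∈ U, ¬P.lt b y := by
  simp [maximals]

variable [DecidableEq α] [Fintype α]

/-- The linear extensions of the restriction of `P` to a set `U` of size `k`, as words. -/
noncomputable def words (P : PartialOrder α) (k : ℕ) (U : Finset α) : Finset (Fin k → α) :=
  univ.filter fun u =>
    Function.Injective u ∧ univ.image u = U ∧ ∀ i j, P.lt (u i) (u j) → i < j

theorem mem_words {u : Fin k → α} :
    u ∈ words P k U ↔
      Function.Injective u ∧ univ.image u = U ∧ ∀ i j, P.lt (u i) (u j) → i < j := by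
  simp [words]

theorem words_zero_empty : words P 0 ∅ = univ :=
  eq_univ_of_forall fun u =>
    mem_words.2 ⟨Function.injective_of_subsingleton u, rfl, fun i => i.elim0⟩

theorem snoc_mem_words_iff {u : Fin k → α} :
    (Fin.snoc u b : Fin (k + 1) → α) ∈ words P (k + 1) U ↔
      b ∈ maximals P U ∧ u ∈ words P k (U.erase b) := by
  have himage : univ.image (Fin.snoc u b : Fin (k + 1) → α) = insert b (univ.image u) := by
    ext x
    simp [Fin.exists_fin_succ', or_comm, eq_comm]
  have hrange : b ∈ Set.range u ↔ b ∈ univ.image u := by simp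
  have horder : (∀ i j, P.lt ((Fin.snoc u b : Fin (k + 1) → α) i)
      ((Fin.snoc u b : Fin (k + 1) → α) j) → i < j) ↔
      (∀ i j, P.lt (u i) (u j) → i < j) ∧ ∀ y ∈ insert b (univ.image u), ¬P.lt b y := by
    simp [Fin.forall_fin_succ', Fin.castSucc_lt_last, forall_and, (Fin.castSucc_lt_last _).not_gt]
  rw [mem_words, mem_words, mem_maximals, Fin.snoc_injective_iff, himage, hrange, horder]
  constructor
  · rintro ⟨⟨hinj, hb⟩, rfl, hlt, hmax⟩
    exact ⟨⟨mem_insert_self _ _, hmax⟩, hinj, (erase_insert hb).symm, hlt⟩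
  · rintro ⟨⟨hb, hmax⟩, hinj, himg, hlt⟩
    rw [himg, insert_erase hb]
    exact ⟨⟨hinj, notMem_erase _ _⟩, rfl, hlt, hmax⟩

theorem sum_words_succ {R : Type*} [AddCommMonoid R] (g : (Fin (k + 1) → α) → R) :
    ∑ u ∈ words P (k + 1) U, g u =
      ∑ b ∈ maximals P U, ∑ v ∈ words P k (U.erase b), g (Fin.snoc v b) := by
  rw [sum_sigma']
  refine (sum_bij' (fun s _ => Fin.snoc s.2 s.1) (fun u _ => ⟨u (Fin.last k), Fin.init u⟩)
    ?_ ?_ ?_ ?_ ?_).symm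
  · exact fun s hs => snoc_mem_words_iff.2 (mem_sigma.1 hs)
  · intro u hu
    rw [← Fin.snoc_init_self u, snoc_mem_words_iff] at hu
    exact mem_sigma.2 hu
  · simp
  · simp
  · simp

end LinearExtensions

section PPartitions

variable {α β : Type*} [LinearOrder β] {P : PartialOrder α} {ω : α → β}
  {A U : Finset α} {a b : α}

/-- The order ideals of `P` contained in `U`. -/
noncomputable def idealsIn (P : PartialOrder α) (U : Finset α) : Finset (Finset α) :=
  U.powerset.filter (IsOrderIdeal P)

theorem mem_idealsIn : A ∈ idealsIn P U ↔ A ⊆ U ∧ IsOrderIdeal P A := by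
  simp [idealsIn]

variable [DecidableEq α]

theorem IsOrderIdeal.erase_of_mem_maximals (hU : IsOrderIdeal P U) (hb : b ∈ maximals P U) :
    IsOrderIdeal P (U.erase b) := by
  intro x y hyx hx
  obtain ⟨hxb, hxU⟩ := mem_erase.1 hx
  refine mem_erase.2 ⟨?_, hU hyx hxU⟩
  rintro rfl
  exact (mem_maximals.1 hb).2 x hxU (@lt_of_le_of_ne _ P _ _ hyx hxb.symm)

/-- The order ideals `A ⊆ U` of `P` such that all labels `ω y` with `y ∈ U \ A` lie below `ω a`. -/
noncomputable def idealsBelow (P : PartialOrder α) (ω : α → β) (U : Finset α) (a : α) :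
    Finset (Finset α) :=
  (idealsIn P U).filter fun A => ∀ y ∈ U \ A, ω y < ω a

theorem mem_idealsBelow :
    A ∈ idealsBelow P ω U a ↔ A ∈ idealsIn P U ∧ ∀ y ∈ U \ A, ω y < ω a := by
  simp [idealsBelow]

/-- A natural labelling of `P`: distinct labels, increasing along `P`. -/
structure IsNaturalLabelling (P : PartialOrder α) (ω : α → β) : Prop where
  injective : Function.Injective ω
  lt : ∀ ⦃a b⦄, P.lt a b → ω a < ω b

variable (hω : IsNaturalLabelling P ω)
include hω

theorem mem_idealsBelow_erase_iff :
    b ∈ maximals P U ∧ A ∈ idealsBelow P ω (U.erase b) b ↔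
      A ∈ idealsIn P U ∧ b ∈ U \ A ∧ ∀ y ∈ U \ A, ω y ≤ ω b := by
  simp only [mem_maximals, mem_idealsBelow, mem_idealsIn, mem_sdiff, mem_erase, subset_erase]
  constructor
  · rintro ⟨⟨hbU, -⟩, ⟨⟨hAU, hbA⟩, hA⟩, hlt⟩
    refine ⟨⟨hAU, hA⟩, ⟨hbU, hbA⟩, fun y ⟨hyU, hyA⟩ => ?_⟩
    obtain rfl | hyb := eq_or_ne y b
    · exact le_rfl
    · exact (hlt y ⟨⟨hyb, hyU⟩, hyA⟩).le
  · rintro ⟨⟨hAU, hA⟩, ⟨hbU, hbA⟩, hle⟩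
    refine ⟨⟨hbU, fun y hyU hby => ?_⟩, ⟨⟨hAU, hbA⟩, hA⟩, fun y ⟨⟨hyb, hyU⟩, hyA⟩ =>
      (hle y ⟨hyU, hyA⟩).lt_of_ne (hω.injective.ne hyb)⟩
    have hyA : y ∉ A := fun hyA => hbA (hA (@le_of_lt _ P.toPreorder _ _ hby) hyA)
    exact (hle y ⟨hyU, hyA⟩).not_gt (hω.lt hby)

theorem idealsIn_erase_self :
    (idealsIn P U).erase U =
      (maximals P U).biUnion fun b => idealsBelow P ω (U.erase b) b := by
  ext A
  simp only [mem_erase, mem_biUnion, mem_idealsBelow_erase_iff hω]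
  constructor
  · rintro ⟨hne, hA⟩
    have hdiff : (U \ A).Nonempty :=
      sdiff_nonempty.2 fun hUA => hne ((mem_idealsIn.1 hA).1.antisymm hUA)
    obtain ⟨b, hb, hmax⟩ := exists_max_image (U \ A) ω hdiff
    exact ⟨b, hA, hb, hmax⟩
  · rintro ⟨b, hA, hb, -⟩
    refine ⟨?_, hA⟩
    rintro rfl
    simp at hb

theorem pairwiseDisjoint_idealsBelow :
    (maximals P U : Set α).PairwiseDisjoint fun b => idealsBelow P ω (U.erase b) b := by
  intro b hb c hc hbc
  refine disjoint_left.2 fun A hAb hAc => hbc (hω.injective ?_)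
  obtain ⟨-, hbA, hmaxb⟩ := (mem_idealsBelow_erase_iff hω).1 ⟨hb, hAb⟩
  obtain ⟨-, hcA, hmaxc⟩ := (mem_idealsBelow_erase_iff hω).1 ⟨hc, hAc⟩
  exact (hmaxc b hbA).antisymm (hmaxb c hcA)

theorem sum_idealsIn {R : Type*} [AddCommMonoid R] (hU : IsOrderIdeal P U) (f : Finset α → R) :
    ∑ A ∈ idealsIn P U, f A =
      f U + ∑ b ∈ maximals P U, ∑ A ∈ idealsBelow P ω (U.erase b) b, f A := by
  rw [← add_sum_erase _ _ (mem_idealsIn.2 ⟨Subset.rfl, hU⟩), idealsIn_erase_self hω,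
    sum_biUnion (pairwiseDisjoint_idealsBelow hω)]

theorem sum_idealsBelow {R : Type*} [AddCommMonoid R] (hU : IsOrderIdeal P U)
    (f : Finset α → R) (a : α) :
    ∑ A ∈ idealsBelow P ω U a, f A =
      f U + ∑ b ∈ maximals P U with ω b < ω a, ∑ A ∈ idealsBelow P ω (U.erase b) b, f A := by
  rw [idealsBelow, sum_filter, sum_idealsIn hω hU, sdiff_self, if_pos (by simp),
    sum_filter]
  congr 1
  refine sum_congr rfl fun b hb => ?_
  have hcond : ∀ A ∈ idealsBelow P ω (U.erase b) b, (∀ y ∈ U \ A, ω y < ω a) ↔ ω b < ω a := by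
    intro A hA
    obtain ⟨-, hbA, hmax⟩ := (mem_idealsBelow_erase_iff hω).1 ⟨hb, hA⟩
    exact ⟨fun h => h b hbA, fun h y hy => (hmax y hy).trans_lt h⟩
  rw [sum_congr rfl fun A hA => if_congr (hcond A hA) rfl rfl]
  split_ifs
  · rfl
  · exact sum_const_zero

end PPartitions

section MajorIndexGeneratingFunction

variable {α β R : Type*} [DecidableEq α] [LinearOrder β] [CommRing R] {P : PartialOrder α}
  {ω : α → β} {x : R} {F : Finset α → R} {U : Finset α}

variable (hω : IsNaturalLabelling P ω)
  (hF : ∀ U, IsOrderIdeal P U → F U = ∑ A ∈ idealsIn P U, x ^ A.card * F A)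
include hω hF

theorem one_sub_pow_card_mul_eq_sum (hU : IsOrderIdeal P U) :
    (1 - x ^ U.card) * F U =
      ∑ b ∈ maximals P U, ∑ A ∈ idealsBelow P ω (U.erase b) b, x ^ A.card * F A := by
  rw [sub_mul, one_mul, sub_eq_iff_eq_add']
  exact (hF U hU).trans (sum_idealsIn hω hU _)

theorem one_sub_pow_card_mul_sum_idealsBelow (hU : IsOrderIdeal P U) {a : α} (ha : a ∉ U) :
    (1 - x ^ U.card) * ∑ A ∈ idealsBelow P ω U a, x ^ A.card * F A =
      ∑ b ∈ maximals P U, (if ω a < ω b then x ^ U.card else 1) *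
        ∑ A ∈ idealsBelow P ω (U.erase b) b, x ^ A.card * F A := by
  rw [sum_idealsBelow hω hU, mul_add, mul_left_comm, one_sub_pow_card_mul_eq_sum hω hF hU,
    sum_filter, mul_sum, mul_sum, ← sum_add_distrib]
  refine sum_congr rfl fun b hb => ?_
  have hne : ω b ≠ ω a := hω.injective.ne (ne_of_mem_of_not_mem (mem_maximals.1 hb).1 ha)
  rcases hne.lt_or_gt with h | h
  · rw [if_neg h.not_gt, if_pos h]
    ring
  · rw [if_pos h, if_neg h.not_gt]
    ring

variable [Fintype α]

theorem sum_words_pow_majWord_snoc (hF0 : F ∅ = 1) {k : ℕ} (hU : IsOrderIdeal P U)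
    (hk : U.card = k) {a : α} (ha : a ∉ U) :
    ∑ u ∈ words P k U, x ^ majWord (Fin.snoc (ω ∘ u) (ω a) : Fin (k + 1) → β) =
      (∏ i ∈ Icc 1 k, (1 - x ^ i)) * ∑ A ∈ idealsBelow P ω U a, x ^ A.card * F A := by
  induction k generalizing U a with
  | zero =>
    obtain rfl := card_eq_zero.1 hk
    rw [sum_idealsBelow hω hU, words_zero_empty]
    simp [majWord_eq_zero_of_le_one, hF0, maximals]
  | succ k ih =>
    have hstep := one_sub_pow_card_mul_sum_idealsBelow hω hF hU ha
    rw [hk] at hstep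
    rw [sum_words_succ, prod_Icc_succ_top (by omega), mul_assoc, hstep, mul_sum]
    refine sum_congr rfl fun b hb => ?_
    have hcard : (U.erase b).card = k := by
      rw [card_erase_of_mem (mem_maximals.1 hb).1, hk, Nat.add_sub_cancel]
    rw [mul_left_comm, ← ih (hU.erase_of_mem_maximals hb) hcard (notMem_erase b U), mul_sum]
    refine sum_congr rfl fun v _ => ?_
    rw [Fin.comp_snoc, majWord_snoc, Fin.snoc_last, pow_add, mul_comm]
    split_ifs <;> simp

theorem sum_words_pow_majWord (hF0 : F ∅ = 1) {k : ℕ} (hU : IsOrderIdeal P U)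
    (hk : U.card = k) :
    ∑ u ∈ words P k U, x ^ majWord (ω ∘ u) = (∏ i ∈ Icc 1 k, (1 - x ^ i)) * F U := by
  cases k with
  | zero =>
    obtain rfl := card_eq_zero.1 hk
    rw [words_zero_empty]
    simp [majWord_eq_zero_of_le_one, hF0]
  | succ k =>
    have hstep := one_sub_pow_card_mul_eq_sum hω hF hU
    rw [hk] at hstep
    rw [sum_words_succ, prod_Icc_succ_top (by omega), mul_assoc, hstep, mul_sum]
    refine sum_congr rfl fun b hb => ?_
    rw [← sum_words_pow_majWord_snoc hω hF hF0 (hU.erase_of_mem_maximals hb)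
      (by rw [card_erase_of_mem (mem_maximals.1 hb).1, hk, Nat.add_sub_cancel])
      (notMem_erase b U)]
    exact sum_congr rfl fun v _ => by rw [Fin.comp_snoc]

end MajorIndexGeneratingFunction

section SumProd

variable {ι R : Type*} [DecidableEq ι] [CommSemiring R] {w c : ι → R} {𝓕 : Finset (Finset ι)}

theorem sum_prod_filter_mem {t : ι} (hw : w t = c t * (1 + w t))
    (h𝓕 : ∀ N, insert t N ∈ 𝓕 ↔ N ∈ 𝓕) :
    ∑ N ∈ 𝓕 with t ∈ N, ∏ i ∈ N, w i = c t * ∑ N ∈ 𝓕, ∏ i ∈ N, w i := by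
  have hinsert : ∑ N ∈ 𝓕 with t ∈ N, ∏ i ∈ N, w i =
      w t * ∑ N ∈ 𝓕 with t ∉ N, ∏ i ∈ N, w i := by
    rw [mul_sum]
    refine sum_bij' (fun N _ => N.erase t) (fun N _ => insert t N) ?_ ?_ ?_ ?_ ?_
    · intro N hN
      obtain ⟨hN, ht⟩ := mem_filter.1 hN
      exact mem_filter.2 ⟨(h𝓕 _).1 ((insert_erase ht).symm ▸ hN), notMem_erase t N⟩
    · intro N hN
      exact mem_filter.2 ⟨(h𝓕 N).2 (mem_filter.1 hN).1, mem_insert_self t N⟩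
    · exact fun N hN => insert_erase (mem_filter.1 hN).2
    · exact fun N hN => erase_insert (mem_filter.1 hN).2
    · exact fun N hN => (mul_prod_erase N w (mem_filter.1 hN).2).symm
  rw [← sum_filter_add_sum_filter_not 𝓕 (t ∈ ·), hinsert, ← add_one_mul, ← mul_assoc,
    add_comm (w t), ← hw]

theorem sum_prod_filter_subset {T : Finset ι} (hw : ∀ t ∈ T, w t = c t * (1 + w t))
    (h𝓕 : ∀ t ∈ T, ∀ N, insert t N ∈ 𝓕 ↔ N ∈ 𝓕) :
    ∑ N ∈ 𝓕 with T ⊆ N, ∏ i ∈ N, w i = (∏ t ∈ T, c t) * ∑ N ∈ 𝓕, ∏ i ∈ N, w i := by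
  induction T using Finset.induction_on with
  | empty => simp
  | insert t T htT ih =>
    have hfilter : 𝓕.filter (insert t T ⊆ ·) = (𝓕.filter (T ⊆ ·)).filter (t ∈ ·) := by
      ext N
      simp only [mem_filter, insert_subset_iff]
      tauto
    have hclosed : ∀ N, insert t N ∈ 𝓕.filter (T ⊆ ·) ↔ N ∈ 𝓕.filter (T ⊆ ·) := fun N => by
      rw [mem_filter, mem_filter, h𝓕 t (mem_insert_self t T), subset_insert_iff_of_notMem htT]
    rw [hfilter, sum_prod_filter_mem (hw t (mem_insert_self t T)) hclosed,
      ih (fun s hs => hw s (mem_insert_of_mem hs)) (fun s hs => h𝓕 s (mem_insert_of_mem hs)),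
      prod_insert htT, mul_assoc]

theorem sum_prod_powerset_filter_subset {T M : Finset ι} (hTM : T ⊆ M)
    (hw : ∀ t ∈ T, w t = c t * (1 + w t)) :
    ∑ N ∈ M.powerset with T ⊆ N, ∏ i ∈ N, w i = (∏ t ∈ T, c t) * ∏ i ∈ M, (1 + w i) := by
  rw [sum_prod_filter_subset hw fun t ht N => by
    rw [mem_powerset, mem_powerset, insert_subset_iff, and_iff_right (hTM ht)], prod_one_add]

end SumProd

section IndependentSets

variable {n : ℕ} {P : PartialOrder (Fin n)} {J K T : ConnIdeal P} {N : Finset (ConnIdeal P)}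
  {A S : Finset (Fin n)}

theorem idealGraph_not_adj_iff : ¬(idealGraph P).Adj J K ↔ Disjoint J.1 K.1 ∨ J ≤ K ∨ K ≤ J := by
  change ¬((J.1 ∩ K.1).Nonempty ∧ ¬J ≤ K ∧ ¬K ≤ J) ↔ _
  rw [disjoint_iff_inter_eq_empty, ← not_nonempty_iff_eq_empty]
  tauto

theorem le_or_le_of_not_adj (h : ¬(idealGraph P).Adj J K) {i : Fin n} (hiJ : i ∈ J.1)
    (hiK : i ∈ K.1) : J ≤ K ∨ K ≤ J :=
  (idealGraph_not_adj_iff.1 h).resolve_left (not_disjoint_iff.2 ⟨i, hiJ, hiK⟩)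

theorem le_or_le_of_mem (hN : (idealGraph P).IsIndepSet N) (hJ : J ∈ N) (hK : K ∈ N) {i : Fin n}
    (hiJ : i ∈ J.1) (hiK : i ∈ K.1) : J ≤ K ∨ K ≤ J := by
  obtain rfl | hne := eq_or_ne J K
  · exact .inl le_rfl
  · exact le_or_le_of_not_adj (hN hJ hK hne) hiJ hiK

theorem isSummand_biUnion_of_maximal (hN : (idealGraph P).IsIndepSet N)
    (hK : Maximal (· ∈ N) K) : IsSummand P K.1 (N.biUnion Subtype.val) where
  subset := subset_biUnion_of_mem Subtype.val hK.prop
  isOrderIdeal := K.2.isOrderIdeal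
  isOrderIdeal_sdiff := by
    intro x y hyx hx
    obtain ⟨hxN, hxK⟩ := mem_sdiff.1 hx
    obtain ⟨J, hJ, hxJ⟩ := mem_biUnion.1 hxN
    have hyJ : y ∈ J.1 := J.2.isOrderIdeal hyx hxJ
    refine mem_sdiff.2 ⟨mem_biUnion.2 ⟨J, hJ, hyJ⟩, fun hyK => hxK ?_⟩
    have hJK : J ≤ K := (le_or_le_of_mem hN hJ hK.prop hyJ hyK).elim id (hK.2 hJ)
    exact hJK hxJ

/-- The independent sets of `G_P` whose members are contained in `S`. -/
noncomputable def indepSetsIn (P : PartialOrder (Fin n)) (S : Finset (Fin n)) :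
    Finset (Finset (ConnIdeal P)) :=
  univ.filter fun N => (idealGraph P).IsIndepSet N ∧ ∀ J ∈ N, J.1 ⊆ S

theorem mem_indepSetsIn :
    N ∈ indepSetsIn P S ↔ (idealGraph P).IsIndepSet N ∧ ∀ J ∈ N, J.1 ⊆ S := by
  simp [indepSetsIn]

theorem not_adj_of_mem_components (hT : T ∈ components P S) (hJ : J.1 ⊆ S) :
    ¬(idealGraph P).Adj T J := by
  refine idealGraph_not_adj_iff.2 (or_iff_not_imp_left.2 fun hmeet => .inr ?_)
  exact J.2.subset_of_isSummand (mem_components.1 hT) hJ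
    (inter_comm T.1 J.1 ▸ not_disjoint_iff_nonempty_inter.1 hmeet)

theorem insert_mem_indepSetsIn_iff (hT : T ∈ components P S) :
    insert T N ∈ indepSetsIn P S ↔ N ∈ indepSetsIn P S := by
  rw [mem_indepSetsIn, mem_indepSetsIn, forall_mem_insert,
    and_iff_right (mem_components.1 hT).subset]
  refine and_congr_left fun hN => ?_
  have : Std.Symm fun J K => ¬(idealGraph P).Adj J K := ⟨fun _ _ h h' => h h'.symm⟩
  rw [coe_insert, SimpleGraph.isIndepSet_iff, Set.pairwise_insert_of_symm]
  exact and_iff_left fun J hJ _ => not_adj_of_mem_components hT (hN J hJ)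

theorem biUnion_eq_iff_components_subset (hS : IsOrderIdeal P S) (hN : N ∈ indepSetsIn P S) :
    N.biUnion Subtype.val = S ↔ components P S ⊆ N := by
  obtain ⟨hindep, hsub⟩ := mem_indepSetsIn.1 hN
  refine ⟨fun hunion T hT => ?_, fun h => (biUnion_subset.2 hsub).antisymm ?_⟩
  · obtain ⟨i, hi⟩ := T.2.nonempty
    have hiN : i ∈ N.biUnion Subtype.val := hunion ▸ (mem_components.1 hT).subset hi
    obtain ⟨J, hJ, hiJ⟩ := mem_biUnion.1 hiN
    obtain ⟨K, hJK, hK⟩ := N.exists_le_maximal hJ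
    have hKS : K ∈ components P S :=
      mem_components.2 (hunion ▸ isSummand_biUnion_of_maximal hindep hK)
    have : T = K := (pairwiseDisjoint_components S).elim_finset hT hKS i hi (hJK hiJ)
    exact this ▸ hK.prop
  · rw [← hS.biUnion_components]
    exact biUnion_subset_biUnion_of_subset_left _ h

/-- The factor `q^{|J|} / [|J|]_q` that a member `J` contributes to the weight of an independent
set of `G_P`. -/
noncomputable def idealWeight (J : ConnIdeal P) : RatFunc ℚ := q ^ J.1.card / qBracket J.1.card

theorem qBracket_ne_zero {i : ℕ} (hi : i ≠ 0) : qBracket i ≠ 0 := by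
  rw [qBracket, sub_ne_zero, q, ← RatFunc.algebraMap_X, ← map_pow,
    ← map_one (algebraMap (Polynomial ℚ) (RatFunc ℚ))]
  refine (RatFunc.algebraMap_injective ℚ).ne fun h => hi ?_
  simpa using congrArg Polynomial.natDegree h.symm

theorem one_add_idealWeight (J : ConnIdeal P) : 1 + idealWeight J = (qBracket J.1.card)⁻¹ := by
  have hne := qBracket_ne_zero (card_ne_zero.2 J.2.nonempty)
  rw [idealWeight, ← div_self hne, ← add_div, qBracket, sub_add_cancel, one_div]

theorem idealWeight_eq (J : ConnIdeal P) : idealWeight J = q ^ J.1.card * (1 + idealWeight J) := by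
  rw [one_add_idealWeight, idealWeight, div_eq_mul_inv]

/-- The generating function of the independent sets of `G_P` with members contained in `S`. For an
order ideal `S` it is also the generating function of the `P`-partitions of `S` by their sum. -/
noncomputable def indepSum (P : PartialOrder (Fin n)) (S : Finset (Fin n)) : RatFunc ℚ :=
  ∑ N ∈ indepSetsIn P S, ∏ J ∈ N, idealWeight J

theorem indepSum_empty : indepSum P ∅ = 1 := by
  have : indepSetsIn P ∅ = {∅} := by
    refine eq_singleton_iff_unique_mem.2 ⟨mem_indepSetsIn.2 (by simp), fun N hN => ?_⟩
    refine eq_empty_of_forall_notMem fun J hJ => J.2.nonempty.ne_empty ?_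
    exact subset_empty.1 ((mem_indepSetsIn.1 hN).2 J hJ)
  rw [indepSum, this, sum_singleton, prod_empty]

theorem sum_indepSetsIn_biUnion_eq (hA : IsOrderIdeal P A) (hAS : A ⊆ S) :
    ∑ N ∈ indepSetsIn P S with N.biUnion Subtype.val = A, ∏ J ∈ N, idealWeight J =
      q ^ A.card * indepSum P A := by
  have hfilter : (indepSetsIn P S).filter (·.biUnion Subtype.val = A) =
      (indepSetsIn P A).filter (components P A ⊆ ·) := by
    ext N
    rw [mem_filter, mem_filter]
    constructor
    · rintro ⟨hN, hNA⟩
      have : N ∈ indepSetsIn P A := mem_indepSetsIn.2 ⟨(mem_indepSetsIn.1 hN).1,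
        fun J hJ => hNA ▸ subset_biUnion_of_mem Subtype.val hJ⟩
      exact ⟨this, (biUnion_eq_iff_components_subset hA this).1 hNA⟩
    · rintro ⟨hN, hcomp⟩
      obtain ⟨hindep, hsub⟩ := mem_indepSetsIn.1 hN
      exact ⟨mem_indepSetsIn.2 ⟨hindep, fun J hJ => (hsub J hJ).trans hAS⟩,
        (biUnion_eq_iff_components_subset hA hN).2 hcomp⟩
  rw [hfilter, sum_prod_filter_subset (c := fun J => q ^ J.1.card) (fun J _ => idealWeight_eq J)
    fun T hT N => insert_mem_indepSetsIn_iff hT, prod_pow_eq_pow_sum, hA.sum_card_components,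
    indepSum]

theorem isOrderIdeal_biUnion (N : Finset (ConnIdeal P)) :
    IsOrderIdeal P (N.biUnion Subtype.val) := by
  intro x y hyx hx
  obtain ⟨J, hJ, hxJ⟩ := mem_biUnion.1 hx
  exact mem_biUnion.2 ⟨J, hJ, J.2.isOrderIdeal hyx hxJ⟩

theorem indepSum_eq_sum_idealsIn (P : PartialOrder (Fin n)) (S : Finset (Fin n)) :
    indepSum P S = ∑ A ∈ idealsIn P S, q ^ A.card * indepSum P A := by
  have hmaps : ∀ N ∈ indepSetsIn P S, N.biUnion Subtype.val ∈ idealsIn P S := fun N hN =>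
    mem_idealsIn.2 ⟨biUnion_subset.2 (mem_indepSetsIn.1 hN).2, isOrderIdeal_biUnion N⟩
  rw [indepSum, ← sum_fiberwise_of_maps_to hmaps]
  refine sum_congr rfl fun A hA => ?_
  exact sum_indepSetsIn_biUnion_eq (mem_idealsIn.1 hA).2 (mem_idealsIn.1 hA).1

theorem NaturallyLabeled.isNaturalLabelling (hP : NaturallyLabeled P) :
    IsNaturalLabelling P (Fin.val : Fin n → ℕ) :=
  ⟨Fin.val_injective, hP⟩

theorem coe_mem_words_iff {w : Equiv.Perm (Fin n)} :
    (w : Fin n → Fin n) ∈ words P n univ ↔ w ∈ linearExtensions P := by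
  simp [mem_words, linearExtensions, IsLinearExtension, w.injective,
    image_univ_of_surjective w.surjective]

theorem sum_linearExtensions (hP : NaturallyLabeled P) :
    ∑ w ∈ linearExtensions P, q ^ maj w = qFactorial n * indepSum P univ := by
  refine Eq.trans ?_ (sum_words_pow_majWord hP.isNaturalLabelling
    (fun U _ => indepSum_eq_sum_idealsIn P U) indepSum_empty isOrderIdeal_univ (card_fin n))
  refine sum_bij (fun w _ => w) (fun w hw => coe_mem_words_iff.2 hw)
    (fun w _ w' _ h => DFunLike.coe_injective h) (fun u hu => ?_) fun w _ => rfl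
  have hbij : Function.Bijective u := Finite.injective_iff_bijective.1 (mem_words.1 hu).1
  exact ⟨Equiv.ofBijective u hbij, coe_mem_words_iff.1 hu, rfl⟩

end IndependentSets

section Labels

variable {n : ℕ} {P : PartialOrder (Fin n)} {J K : ConnIdeal P} {M : Finset (ConnIdeal P)}
  {i : Fin n}

theorem mem_mu : i ∈ mu M J ↔ ∃ K ∈ M, K < J ∧ i ∈ K.1 := by
  simp only [mu, mem_biUnion, mem_filter, and_assoc]
  rfl

theorem sdiff_mu_nonempty (hM : (idealGraph P).IsIndepSet M) (J : ConnIdeal P) :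
    (J.1 \ mu M J).Nonempty := by
  by_contra! h
  let N := M.filter (· < J)
  have hN : (idealGraph P).IsIndepSet N := hM.mono (coe_subset.2 (filter_subset _ M))
  have hmem : ∀ {K}, K ∈ N → K < J := fun hK => (mem_filter.1 hK).2
  have hJN : N.biUnion Subtype.val = J.1 :=
    (biUnion_subset.2 fun K hK => (hmem hK).le).antisymm (sdiff_eq_empty_iff_subset.1 h)
  obtain ⟨i, hi⟩ := J.2.nonempty
  obtain ⟨K, hK, -⟩ := mem_biUnion.1 (hJN.ge hi)
  obtain ⟨L, -, hL⟩ := N.exists_le_maximal hK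
  have hLJ : L.1 = J.1 :=
    (isConnIdeal_iff.1 J.2).2.2 L.1 (hJN ▸ isSummand_biUnion_of_maximal hN hL) L.2.nonempty
  exact (hmem hL.prop).ne (Subtype.ext hLJ)

theorem le_of_mem_sdiff_mu (hM : (idealGraph P).IsIndepSet M) (hJ : J ∈ M) (hK : K ∈ M)
    (hiJ : i ∈ J.1 \ mu M J) (hiK : i ∈ K.1) : J ≤ K := by
  obtain ⟨hiJ, hi⟩ := mem_sdiff.1 hiJ
  refine (le_or_le_of_mem hM hJ hK hiJ hiK).elim id fun hKJ => ?_
  exact le_of_eq (hKJ.eq_or_lt.resolve_right fun hlt => hi (mem_mu.2 ⟨K, hK, hlt, hiK⟩)).symm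

theorem eq_of_mem_sdiff_mu (hM : (idealGraph P).IsIndepSet M) (hJ : J ∈ M) (hK : K ∈ M)
    (hiJ : i ∈ J.1 \ mu M J) (hiK : i ∈ K.1 \ mu M K) : J = K :=
  (le_of_mem_sdiff_mu hM hJ hK hiJ (mem_sdiff.1 hiK).1).antisymm
    (le_of_mem_sdiff_mu hM hK hJ hiK (mem_sdiff.1 hiJ).1)

theorem card_le_of_isIndepSet (hM : (idealGraph P).IsIndepSet M) : M.card ≤ n := by
  choose label hlabel using sdiff_mu_nonempty hM
  have hinj : Set.InjOn label M := fun J hJ K hK h =>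
    eq_of_mem_sdiff_mu hM hJ hK (hlabel J) (h ▸ hlabel K)
  simpa using card_le_card_of_injOn label (fun _ _ => mem_univ _) hinj

end Labels

section InsertionFamily

variable {n : ℕ} {P : PartialOrder (Fin n)} {β : Type*} [LinearOrder β] {κ : Fin n → β}
  {J K : ConnIdeal P} {M : Finset (ConnIdeal P)} {i : Fin n}

/-- The connected order ideals that arise when the elements are inserted in the order of
increasing `κ`: for each `i`, the component of `i` in `{j | κ j ≤ κ i}`. -/
noncomputable def insertionFamily (P : PartialOrder (Fin n)) (κ : Fin n → β) :
    Finset (ConnIdeal P) :=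
  univ.filter fun J => ∃ i ∈ J.1, IsSummand P J.1 (univ.filter (κ · ≤ κ i))

theorem mem_insertionFamily :
    J ∈ insertionFamily P κ ↔ ∃ i ∈ J.1, IsSummand P J.1 (univ.filter (κ · ≤ κ i)) := by
  simp [insertionFamily]

theorem le_of_isSummand_of_le {j : Fin n} (hJ : IsSummand P J.1 (univ.filter (κ · ≤ κ i)))
    (hK : IsSummand P K.1 (univ.filter (κ · ≤ κ j))) (hij : κ i ≤ κ j)
    (hne : (J.1 ∩ K.1).Nonempty) : J ≤ K :=
  J.2.subset_of_isSummand hK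
    (hJ.subset.trans fun _ hx => by
      simpa using (mem_filter.1 hx).2.trans hij) hne

theorem isIndepSet_insertionFamily : (idealGraph P).IsIndepSet (insertionFamily P κ) := by
  intro J hJ K hK _
  obtain ⟨i, -, hJ⟩ := mem_insertionFamily.1 hJ
  obtain ⟨j, -, hK⟩ := mem_insertionFamily.1 hK
  refine idealGraph_not_adj_iff.2 (or_iff_not_imp_left.2 fun hmeet => ?_)
  have hne := not_disjoint_iff_nonempty_inter.1 hmeet
  exact (le_total (κ i) (κ j)).imp (le_of_isSummand_of_le hJ hK · hne)
    (le_of_isSummand_of_le hK hJ · (inter_comm J.1 K.1 ▸ hne))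

theorem mem_sdiff_mu_of_isSummand (hi : i ∈ J.1)
    (hJ : IsSummand P J.1 (univ.filter (κ · ≤ κ i))) :
    i ∈ J.1 \ mu (insertionFamily P κ) J := by
  refine mem_sdiff.2 ⟨hi, fun hmu => ?_⟩
  obtain ⟨K, hK, hKJ, hiK⟩ := mem_mu.1 hmu
  obtain ⟨j, -, hK⟩ := mem_insertionFamily.1 hK
  have hij : κ i ≤ κ j := (mem_filter.1 (hK.subset hiK)).2
  exact hKJ.not_ge (le_of_isSummand_of_le hJ hK hij ⟨i, mem_inter.2 ⟨hi, hiK⟩⟩)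

theorem card_insertionFamily (hκ : Function.Injective κ) (hmono : ∀ a b, P.le a b → κ a ≤ κ b) :
    (insertionFamily P κ).card = n := by
  refine (card_le_of_isIndepSet isIndepSet_insertionFamily).antisymm ?_
  have hideal : ∀ i, IsOrderIdeal P (univ.filter (κ · ≤ κ i)) := fun i a b hba ha => by
    simp only [coe_filter, mem_univ, true_and, Set.mem_ofPred_eq] at ha ⊢
    exact (hmono b a hba).trans ha
  have hexists : ∀ i, ∃ J : ConnIdeal P, IsSummand P J.1 (univ.filter (κ · ≤ κ i)) ∧ i ∈ J.1 :=
    fun i => (hideal i).exists_isSummand_connIdeal (by simp)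
  choose J hJ hiJ using hexists
  have hle : ∀ i j, J i = J j → κ i ≤ κ j := fun i j h =>
    (mem_filter.1 ((hJ j).subset (h ▸ hiJ i))).2
  have hinj : Function.Injective J := fun i j h => hκ ((hle i j h).antisymm (hle j i h.symm))
  simpa using card_le_card_of_injOn (s := univ) J
    (fun i _ => mem_insertionFamily.2 ⟨i, hiJ i, hJ i⟩) hinj.injOn

theorem isMaximumIndepSet_iff :
    (idealGraph P).IsMaximumIndepSet M ↔ (idealGraph P).IsIndepSet M ∧ M.card = n := by
  refine ⟨fun h => ⟨h.isIndepSet, (card_le_of_isIndepSet h.isIndepSet).antisymm ?_⟩,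
    fun h => ⟨h.1, fun N hN => (card_le_of_isIndepSet hN).trans h.2.ge⟩⟩
  let κ : Fin n → LinearExtension (Fin n) := @toLinearExtension (Fin n) P
  have hcard : (insertionFamily P κ).card = n :=
    card_insertionFamily (fun _ _ h => h) fun a b hab => (@toLinearExtension (Fin n) P).monotone hab
  exact hcard.ge.trans (h.maximum _ isIndepSet_insertionFamily)

end InsertionFamily

section Forest

variable {n : ℕ} {P : PartialOrder (Fin n)} {M : MaxIndep P} {J : ConnIdeal P} {i j : Fin n}

theorem exists_labelling (M : MaxIndep P) :
    ∃ label : ConnIdeal P → Fin n, Set.SurjOn label M.1 Set.univ ∧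
      ∀ J ∈ M.1, J.1 \ mu M.1 J = {label J} := by
  obtain ⟨hindep, hcard⟩ := isMaximumIndepSet_iff.1 M.2
  choose label hlabel using sdiff_mu_nonempty hindep
  have hinj : Set.InjOn label M.1 := fun J hJ K hK h =>
    eq_of_mem_sdiff_mu hindep hJ hK (hlabel J) (h ▸ hlabel K)
  have hsurj : Set.SurjOn label M.1 (univ : Finset (Fin n)) :=
    surjOn_of_injOn_of_card_le label (fun _ _ => mem_coe.2 (mem_univ _)) hinj (by simp [hcard])
  refine ⟨label, by simpa using hsurj, fun J hJ => ?_⟩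
  refine eq_singleton_iff_unique_mem.2 ⟨hlabel J, fun i hi => ?_⟩
  obtain ⟨K, hK, rfl⟩ := hsurj (mem_coe.2 (mem_univ i))
  rw [eq_of_mem_sdiff_mu hindep hJ hK hi (hlabel K)]

theorem exists_sdiff_mu_eq (M : MaxIndep P) (i : Fin n) : ∃ J ∈ M.1, J.1 \ mu M.1 J = {i} := by
  obtain ⟨label, hsurj, hlabel⟩ := exists_labelling M
  obtain ⟨J, hJ, rfl⟩ := hsurj (Set.mem_univ i)
  exact ⟨J, hJ, hlabel J hJ⟩

/-- The node of the forest `F_M` with label `i`: the `J ∈ M` with `J \ μ(M, J) = {i}`. It is the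
smallest member of `M` that contains `i`. -/
noncomputable def node (M : MaxIndep P) (i : Fin n) : ConnIdeal P :=
  (exists_sdiff_mu_eq M i).choose

theorem node_mem (M : MaxIndep P) (i : Fin n) : node M i ∈ M.1 :=
  (exists_sdiff_mu_eq M i).choose_spec.1

theorem node_sdiff_mu (M : MaxIndep P) (i : Fin n) : (node M i).1 \ mu M.1 (node M i) = {i} :=
  (exists_sdiff_mu_eq M i).choose_spec.2

theorem mem_node_sdiff_mu (M : MaxIndep P) (i : Fin n) :
    i ∈ (node M i).1 \ mu M.1 (node M i) :=
  node_sdiff_mu M i ▸ mem_singleton_self i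

theorem self_mem_node (M : MaxIndep P) (i : Fin n) : i ∈ (node M i).1 :=
  (mem_sdiff.1 (mem_node_sdiff_mu M i)).1

theorem node_le_iff (hJ : J ∈ M.1) : node M i ≤ J ↔ i ∈ J.1 :=
  ⟨fun h => h (self_mem_node M i),
    le_of_mem_sdiff_mu M.2.isIndepSet (node_mem M i) hJ (mem_node_sdiff_mu M i)⟩

theorem node_eq_of_mem_sdiff_mu (hJ : J ∈ M.1) (hi : i ∈ J.1 \ mu M.1 J) : node M i = J :=
  eq_of_mem_sdiff_mu M.2.isIndepSet (node_mem M i) hJ (mem_node_sdiff_mu M i) hi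

theorem exists_node_eq (hJ : J ∈ M.1) : ∃ i, node M i = J :=
  (sdiff_mu_nonempty M.2.isIndepSet J).imp fun _ => node_eq_of_mem_sdiff_mu hJ

theorem node_injective (M : MaxIndep P) : Function.Injective (node M) := fun i j h =>
  singleton_injective (by rw [← node_sdiff_mu M i, h, node_sdiff_mu])

theorem forest_lt_iff : (forest M).lt i j ↔ node M i < node M j := by
  constructor
  · rintro ⟨J, hJ, K, hK, hi, hj, hJK⟩
    rwa [node_eq_of_mem_sdiff_mu hJ (hi ▸ mem_singleton_self i),
      node_eq_of_mem_sdiff_mu hK (hj ▸ mem_singleton_self j)]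
  · exact fun h => ⟨_, node_mem M i, _, node_mem M j, node_sdiff_mu M i, node_sdiff_mu M j, h⟩

theorem forest_covBy_iff :
    @CovBy (Fin n) (forest M).toLT i j ↔ IsLeast {L ∈ M.1 | node M i < L} (node M j) := by
  constructor
  · rintro ⟨hij, hcov⟩
    rw [forest_lt_iff] at hij
    refine ⟨⟨node_mem M j, hij⟩, fun L ⟨hLM, hiL⟩ => ?_⟩
    obtain ⟨k, rfl⟩ := exists_node_eq hLM
    rcases le_or_le_of_mem M.2.isIndepSet (node_mem M j) hLM (hij.le (self_mem_node M i))
      (hiL.le (self_mem_node M i)) with hjk | hkj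
    · exact hjk
    · exact (hkj.eq_or_lt.resolve_right fun h =>
        hcov (forest_lt_iff.2 hiL) (forest_lt_iff.2 h)).ge
  · rintro ⟨hij, hmin⟩
    refine ⟨forest_lt_iff.2 hij.2, fun k hik hkj => (forest_lt_iff.1 hkj).not_ge ?_⟩
    exact hmin ⟨node_mem M k, forest_lt_iff.1 hik⟩

theorem mem_des_iff :
    i ∈ des M ↔ ∃ j, IsLeast {L ∈ M.1 | node M i < L} (node M j) ∧ (j : ℕ) < i := by
  simp only [← forest_covBy_iff]
  rfl

theorem desBarIn_subset (Mr : Finset (ConnIdeal P)) (M : MaxIndep P) : desBarIn Mr M ⊆ Mr :=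
  filter_subset _ Mr

theorem node_mem_desBarIn_iff {Mr : Finset (ConnIdeal P)} :
    node M i ∈ desBarIn Mr M ↔ node M i ∈ Mr ∧ i ∈ des M := by
  rw [desBarIn, mem_filter]
  refine and_congr_right fun hi => ⟨?_, ?_⟩
  · rintro ⟨j, ⟨hdes, -⟩, hj⟩
    rw [node_sdiff_mu, singleton_inj] at hj
    exact hj ▸ hdes
  · exact fun hdes => ⟨i, ⟨hdes, _, hi, node_sdiff_mu M i⟩, node_sdiff_mu M i⟩

end Forest

section Height

variable {n : ℕ} {P : PartialOrder (Fin n)} {N : Finset (ConnIdeal P)} {J : ConnIdeal P}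
  {i j : Fin n}

/-- The number of members of `N` that contain `i`. -/
noncomputable def height (N : Finset (ConnIdeal P)) (i : Fin n) : ℕ := (N.filter (i ∈ ·.1)).card

/-- The insertion order determined by `N`: the elements of largest height come first, and elements
of equal height come in the order of their labels. -/
noncomputable def key (N : Finset (ConnIdeal P)) (i : Fin n) : ℕᵒᵈ ×ₗ ℕ :=
  toLex (OrderDual.toDual (height N i), (i : ℕ))

theorem key_le_iff : key N i ≤ key N j ↔
    height N j < height N i ∨ height N i = height N j ∧ (i : ℕ) ≤ j := by
  simp [key, Prod.Lex.toLex_le_toLex]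

theorem key_lt_iff : key N i < key N j ↔
    height N j < height N i ∨ height N i = height N j ∧ (i : ℕ) < j := by
  simp [key, Prod.Lex.toLex_lt_toLex]

theorem key_injective (N : Finset (ConnIdeal P)) : Function.Injective (key N) := fun _ _ h =>
  Fin.ext (congrArg (fun k : ℕᵒᵈ ×ₗ ℕ => (ofLex k).2) h)

theorem key_mono (hP : NaturallyLabeled P) (N : Finset (ConnIdeal P)) (hij : P.le i j) :
    key N i ≤ key N j := by
  have hheight : height N j ≤ height N i :=
    card_le_card (monotone_filter_right N fun L _ hj => L.2.isOrderIdeal hij hj)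
  have hlabel : (i : ℕ) ≤ j := by
    obtain rfl | hne := eq_or_ne i j
    · exact le_rfl
    · exact (hP i j (@lt_of_le_of_ne _ P _ _ hij hne)).le
  exact key_le_iff.2 (hheight.lt_or_eq.imp id fun h => ⟨h.symm, hlabel⟩)

theorem height_lt_height (hN : (idealGraph P).IsIndepSet N) (hJ : J ∈ N) (hi : i ∈ J.1)
    (hjJ : j ∉ J.1) {k : Fin n} (hk : k ∈ J.1) (hkj : P.le k j) : height N j < height N i := by
  refine card_lt_card ⟨fun L hL => ?_, fun h => ?_⟩
  · obtain ⟨hLN, hjL⟩ := mem_filter.1 hL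
    have hJL : J ≤ L := (le_or_le_of_mem hN hJ hLN hk (L.2.isOrderIdeal hkj hjL)).resolve_right
      fun hLJ => hjJ (hLJ hjL)
    exact mem_filter.2 ⟨hLN, hJL hi⟩
  · exact hjJ (mem_filter.1 (h (mem_filter.2 ⟨hJ, hi⟩))).2

theorem subset_insertionFamily_key (hP : NaturallyLabeled P) (hN : (idealGraph P).IsIndepSet N) :
    N ⊆ insertionFamily P (key N) := by
  intro J hJ
  obtain ⟨i, hi, hmax⟩ := J.1.exists_max_image (key N) J.2.nonempty
  refine mem_insertionFamily.2 ⟨i, hi, fun x hx => mem_filter.2 ⟨mem_univ x, hmax x hx⟩,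
    J.2.isOrderIdeal, fun x y hyx hx => ?_⟩
  obtain ⟨hxi, hxJ⟩ := mem_sdiff.1 hx
  have hxi : key N x ≤ key N i := (mem_filter.1 hxi).2
  refine mem_sdiff.2 ⟨mem_filter.2 ⟨mem_univ y, (key_mono hP N hyx).trans hxi⟩, fun hyJ => ?_⟩
  exact hxi.not_gt (key_lt_iff.2 (.inl (height_lt_height hN hJ hi hxJ hyJ hyx)))

end Height

section Fibres

variable {n : ℕ} {P : PartialOrder (Fin n)} {N : Finset (ConnIdeal P)} {M : MaxIndep P}

/-- The maximum independent set produced by the insertion order that `N` determines. -/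
noncomputable def maxIndepOf (hP : NaturallyLabeled P) (N : Finset (ConnIdeal P)) : MaxIndep P :=
  ⟨insertionFamily P (key N), isMaximumIndepSet_iff.2 ⟨isIndepSet_insertionFamily,
    card_insertionFamily (key_injective N) fun _ _ => key_mono hP N⟩⟩

theorem isSummand_node {β : Type*} [LinearOrder β] {κ : Fin n → β} {i : Fin n}
    (hM : M.1 = insertionFamily P κ) :
    IsSummand P (node M i).1 (univ.filter (κ · ≤ κ i)) := by
  obtain ⟨j, hj, hsummand⟩ := mem_insertionFamily.1 (hM ▸ node_mem M i)
  have hnode : node M j = node M i :=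
    node_eq_of_mem_sdiff_mu (node_mem M i) (hM ▸ mem_sdiff_mu_of_isSummand hj hsummand)
  exact node_injective M hnode ▸ hsummand

theorem desBarIn_maxIndepOf_subset (hP : NaturallyLabeled P) (hN : (idealGraph P).IsIndepSet N) :
    desBarIn (maxIndepOf hP N).1 (maxIndepOf hP N) ⊆ N := by
  intro J hJ
  set M := maxIndepOf hP N
  obtain ⟨i, rfl⟩ := exists_node_eq (mem_filter.1 hJ).1
  obtain ⟨j, hleast, hji⟩ := mem_des_iff.1 (node_mem_desBarIn_iff.1 hJ).2
  have hij : key N i ≤ key N j :=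
    (mem_filter.1 ((isSummand_node (M := M) rfl).subset
      (hleast.1.2.le (self_mem_node M i)))).2
  have hheight : height N j < height N i :=
    (key_le_iff.1 hij).resolve_right fun h => hji.not_ge h.2
  obtain ⟨L, hLi, hLj⟩ := exists_mem_notMem_of_card_lt_card hheight
  obtain ⟨hLN, hiL⟩ := mem_filter.1 hLi
  have hLM : L ∈ M.1 := subset_insertionFamily_key hP hN hLN
  have hLeq : node M i = L := by
    refine ((node_le_iff hLM).2 hiL).eq_or_lt.resolve_right fun hlt => hLj ?_
    exact mem_filter.2 ⟨hLN, (node_le_iff hLM).1 (hleast.2 ⟨hLM, hlt⟩)⟩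
  exact hLeq ▸ hLN

theorem eq_insertionFamily_of_strictMono {β : Type*} [LinearOrder β] {κ : Fin n → β}
    (hκ : ∀ i j, (forest M).lt i j → κ i < κ j) : M.1 = insertionFamily P κ := by
  have hmono : ∀ i j, node M i ≤ node M j → κ i ≤ κ j := fun i j hij => by
    obtain heq | hlt := hij.eq_or_lt
    · rw [node_injective M heq]
    · exact (hκ i j (forest_lt_iff.2 hlt)).le
  refine eq_of_subset_of_card_le (fun J hJ => ?_)
    (M.2.maximum _ isIndepSet_insertionFamily)
  obtain ⟨i, rfl⟩ := exists_node_eq hJ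
  refine mem_insertionFamily.2 ⟨i, self_mem_node M i, fun x hx => ?_, (node M i).2.isOrderIdeal,
    fun x y hyx hx => ?_⟩
  · exact mem_filter.2 ⟨mem_univ x, hmono x i ((node_le_iff hJ).2 hx)⟩
  · obtain ⟨hxi, hxJ⟩ := mem_sdiff.1 hx
    have hxi : κ x ≤ κ i := (mem_filter.1 hxi).2
    have hynode : y ∈ (node M x).1 := (node M x).2.isOrderIdeal hyx (self_mem_node M x)
    have hyx' : κ y ≤ κ x := hmono y x ((node_le_iff (node_mem M x)).2 hynode)
    refine mem_sdiff.2 ⟨mem_filter.2 ⟨mem_univ y, hyx'.trans hxi⟩, fun hyJ => ?_⟩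
    have hle : node M i ≤ node M x :=
      (le_or_le_of_mem M.2.isIndepSet hJ (node_mem M x) hyJ hynode).resolve_right
        fun h => hxJ (h (self_mem_node M x))
    have hlt : node M i < node M x := lt_of_le_not_ge hle fun h => hxJ (h (self_mem_node M x))
    exact hxi.not_gt (hκ i x (forest_lt_iff.2 hlt))

theorem key_lt_key_of_covBy (hN : desBarIn M.1 M ⊆ N) (hNM : N ⊆ M.1) {i j : Fin n}
    (hij : @CovBy (Fin n) (forest M).toLT i j) : key N i < key N j := by
  have hleast := forest_covBy_iff.1 hij
  have hlt : node M i < node M j := hleast.1.2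
  have hsub : N.filter (j ∈ ·.1) ⊆ N.filter (i ∈ ·.1) :=
    monotone_filter_right N fun L hL hjL =>
      (node_le_iff (hNM hL)).1 (hlt.le.trans ((node_le_iff (hNM hL)).2 hjL))
  refine key_lt_iff.2 ((card_le_card hsub).lt_or_eq.imp id fun hheight => ⟨hheight.symm, ?_⟩)
  have hfilter := eq_of_subset_of_card_le hsub hheight.ge
  by_contra! hji
  have hdes : i ∈ des M := mem_des_iff.2 ⟨j, hleast, hji.lt_of_ne fun h =>
    hlt.ne (congrArg (node M) (Fin.ext h).symm)⟩
  have hiN : node M i ∈ N.filter (j ∈ ·.1) := hfilter ▸ mem_filter.2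
    ⟨hN (node_mem_desBarIn_iff.2 ⟨node_mem M i, hdes⟩), self_mem_node M i⟩
  exact hlt.not_ge ((node_le_iff (node_mem M i)).2 (mem_filter.1 hiN).2)

theorem maxIndepOf_eq_iff (hP : NaturallyLabeled P) (hN : (idealGraph P).IsIndepSet N) :
    maxIndepOf hP N = M ↔ desBarIn M.1 M ⊆ N ∧ N ⊆ M.1 := by
  constructor
  · rintro rfl
    exact ⟨desBarIn_maxIndepOf_subset hP hN, subset_insertionFamily_key hP hN⟩
  · rintro ⟨hdes, hNM⟩
    let : @LocallyFiniteOrder (Fin n) (forest M).toPreorder :=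
      @Fintype.toLocallyFiniteOrder _ (forest M).toPreorder _ _ _
    have hmono : @StrictMono _ _ (forest M).toPreorder _ (key N) :=
      (@strictMono_iff_forall_covBy _ _ (forest M).toPreorder _ _ _).2
        fun i j => key_lt_key_of_covBy hdes hNM
    exact Subtype.ext (eq_insertionFamily_of_strictMono fun i j h => hmono h).symm

theorem indepSum_univ (hP : NaturallyLabeled P) :
    indepSum P univ =
      ∑ M : MaxIndep P, (∏ J ∈ desBarIn M.1 M, q ^ J.1.card) / ∏ J ∈ M.1, qBracket J.1.card := by
  rw [indepSum, ← sum_fiberwise_of_maps_to (fun N _ => mem_univ (maxIndepOf hP N))]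
  refine sum_congr rfl fun M _ => ?_
  have hfilter : (indepSetsIn P univ).filter (maxIndepOf hP · = M) =
      M.1.powerset.filter (desBarIn M.1 M ⊆ ·) := by
    ext N
    rw [mem_filter, mem_filter, mem_powerset, mem_indepSetsIn]
    constructor
    · rintro ⟨⟨hN, -⟩, hNM⟩
      exact ((maxIndepOf_eq_iff hP hN).1 hNM).symm
    · rintro ⟨hNM, hdes⟩
      have hN : (idealGraph P).IsIndepSet N := M.2.isIndepSet.mono (coe_subset.2 hNM)
      exact ⟨⟨hN, fun J _ => subset_univ J.1⟩, (maxIndepOf_eq_iff hP hN).2 ⟨hdes, hNM⟩⟩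
  have hsub := desBarIn_subset M.1 M
  rw [hfilter, sum_prod_powerset_filter_subset hsub fun J _ => idealWeight_eq J,
    prod_congr rfl fun J _ => one_add_idealWeight J, prod_inv_distrib, div_eq_mul_inv]

end Fibres

section GraphComponents

variable {V : Type*} {G : SimpleGraph V} {C : G.ConnectedComponent} {M S : Finset V} {v : V}

theorem supp_subset_of_adj_closed {s : Set V} (hv : v ∈ C.supp) (hvs : v ∈ s)
    (hs : ∀ u ∈ C.supp, ∀ w, G.Adj u w → u ∈ s → w ∈ s) : C.supp ⊆ s := by
  intro w hw
  obtain ⟨walk⟩ := C.reachable_of_mem_supp hv hw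
  by_contra hws
  obtain ⟨d, hd, hfst, hsnd⟩ := walk.exists_boundary_dart s hvs hws
  have hC : d.fst ∈ C.supp := by
    have hreach := walk.takeUntil d.fst (walk.dart_fst_mem_support_of_mem_darts hd) |>.reachable
    exact (SimpleGraph.ConnectedComponent.eq.2 hreach).symm.trans hv
  exact hsnd (hs d.fst hC d.snd d.adj hfst)

theorem supp_subset_singleton_of_isIsolated (hv : v ∈ C.supp) (hiso : G.IsIsolated v) :
    C.supp ⊆ {v} :=
  supp_subset_of_adj_closed hv rfl fun _ _ w hadj huv => absurd (huv ▸ hadj) (hiso w)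

theorem mem_of_isIsolated [Finite V] (hM : G.IsMaximumIndepSet M) (hiso : G.IsIsolated v) :
    v ∈ M := by
  by_contra hv
  have hindep : G.IsIndepSet (insert v M : Finset V) := by
    have : Std.Symm fun u w => ¬G.Adj u w := ⟨fun _ _ h h' => h h'.symm⟩
    rw [coe_insert, SimpleGraph.isIndepSet_iff, Set.pairwise_insert_of_symm]
    exact ⟨hM.isIndepSet, fun w _ _ => hiso w⟩
  exact (hM.maximum _ hindep).not_gt (card_lt_card (ssubset_insert hv))

/-- `S` is an independent set of largest possible size among those contained in `s`. -/
structure IsMaximumIndepSetIn (G : SimpleGraph V) (s : Set V) (S : Finset V) : Prop where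
  subset : (S : Set V) ⊆ s
  isIndepSet : G.IsIndepSet S
  card_le : ∀ T : Finset V, (T : Set V) ⊆ s → G.IsIndepSet T → T.card ≤ S.card

theorem isMaximumIndepSet_toSimpleGraph_iff [Finite V] {S : Finset C} :
    C.toSimpleGraph.IsMaximumIndepSet S ↔
      IsMaximumIndepSetIn G C.supp (S.map (Function.Embedding.subtype _)) := by
  have hindep : ∀ T : Finset C, C.toSimpleGraph.IsIndepSet T ↔
      G.IsIndepSet (T.map (Function.Embedding.subtype (· ∈ C))) := fun T => by
    rw [coe_map]
    exact (Subtype.val_injective.injOn.pairwise_image (r := fun v w => ¬G.Adj v w)).symm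
  constructor
  · rintro ⟨hS, hmax⟩
    refine ⟨fun v hv => property_of_mem_map_subtype S hv, (hindep S).1 hS, fun T hTC hT => ?_⟩
    have hmap : (T.subtype (· ∈ C)).map (Function.Embedding.subtype _) = T :=
      subtype_map_of_mem fun v hv => hTC hv
    rw [← hmap] at hT ⊢
    simpa only [card_map] using hmax (T.subtype (· ∈ C)) ((hindep _).2 hT)
  · refine fun h => ⟨(hindep S).2 h.isIndepSet, fun T hT => ?_⟩
    simpa only [card_map] using
      h.card_le _ (fun v hv => property_of_mem_map_subtype T hv) ((hindep T).1 hT)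

/-- The part `M ∩ V(C)` of a set `M` of vertices that lies in the component `C`. -/
noncomputable def part (C : G.ConnectedComponent) (M : Finset V) : Finset V :=
  M.filter (· ∈ C.supp)

theorem mem_part : v ∈ part C M ↔ v ∈ M ∧ v ∈ C.supp := mem_filter

theorem coe_part (C : G.ConnectedComponent) (M : Finset V) :
    (part C M : Set V) = (M : Set V) ∩ C.supp :=
  coe_filter _ M

theorem inter_supp_eq_iff : (M : Set V) ∩ C.supp = S ↔ part C M = S := by
  rw [← coe_part, coe_inj]

theorem ext_of_part_eq {N : Finset V} (h : ∀ C : G.ConnectedComponent, part C M = part C N) :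
    M = N := by
  ext v
  have hv : v ∈ (G.connectedComponentMk v).supp := rfl
  have := congrArg (v ∈ ·) (h (G.connectedComponentMk v))
  simpa only [mem_part, hv, and_true] using this.to_iff

theorem isIndepSet_iff_forall_part :
    G.IsIndepSet M ↔ ∀ C : G.ConnectedComponent, G.IsIndepSet (part C M) := by
  refine ⟨fun h C => h.mono (coe_subset.2 (filter_subset _ M)), fun h v hv w hw hne hadj => ?_⟩
  have hv' : v ∈ (G.connectedComponentMk v).supp := rfl
  exact h _ (mem_part.2 ⟨hv, hv'⟩)
    (mem_part.2 ⟨hw, ((SimpleGraph.ConnectedComponent.mem_supp_congr_adj _ hadj).1 hv')⟩) hne hadj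

theorem prod_part [Fintype G.ConnectedComponent] {R : Type*} [CommMonoid R] (M : Finset V)
    (f : V → R) : ∏ C : G.ConnectedComponent, ∏ v ∈ part C M, f v = ∏ v ∈ M, f v :=
  prod_fiberwise_of_maps_to (fun v _ => mem_univ (G.connectedComponentMk v)) f

theorem sum_card_part [Fintype G.ConnectedComponent] (M : Finset V) :
    ∑ C : G.ConnectedComponent, (part C M).card = M.card :=
  (card_eq_sum_card_fiberwise fun v _ => mem_univ (G.connectedComponentMk v)).symm

theorem isMaximumIndepSetIn_part [Finite V] (hM : G.IsMaximumIndepSet M)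
    (C : G.ConnectedComponent) : IsMaximumIndepSetIn G C.supp (part C M) where
  subset := coe_part C M ▸ Set.inter_subset_right
  isIndepSet := isIndepSet_iff_forall_part.1 hM.isIndepSet C
  card_le := by
    intro T hTC hT
    have hdisj : Disjoint T (M.filter (· ∉ C.supp)) :=
      disjoint_left.2 fun v hv hv' => (mem_filter.1 hv').2 (hTC hv)
    have hindep : G.IsIndepSet (T ∪ M.filter (· ∉ C.supp) : Finset V) := by
      intro v hv w hw hne hadj
      have hC := SimpleGraph.ConnectedComponent.mem_supp_congr_adj C hadj
      rw [mem_coe, mem_union, mem_filter] at hv hw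
      obtain hv | hv := hv <;> obtain hw | hw := hw
      · exact hT hv hw hne hadj
      · exact hw.2 (hC.1 (hTC hv))
      · exact hv.2 (hC.2 (hTC hw))
      · exact hM.isIndepSet hv.1 hw.1 hne hadj
    have hcard := hM.maximum _ hindep
    rw [card_union_of_disjoint hdisj,
      ← card_filter_add_card_filter_not (s := M) (· ∈ C.supp)] at hcard
    exact le_of_add_le_add_right hcard

theorem isMaximumIndepSet_iff_forall_part [Finite V] :
    G.IsMaximumIndepSet M ↔
      ∀ C : G.ConnectedComponent, IsMaximumIndepSetIn G C.supp (part C M) := by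
  refine ⟨isMaximumIndepSetIn_part, fun h =>
    ⟨isIndepSet_iff_forall_part.2 fun C => (h C).isIndepSet, fun N hN => ?_⟩⟩
  have := Fintype.ofFinite G.ConnectedComponent
  rw [← sum_card_part (G := G) N, ← sum_card_part (G := G) M]
  refine sum_le_sum fun C _ => (h C).card_le _ ?_ (isIndepSet_iff_forall_part.1 hN C)
  exact coe_part C N ▸ Set.inter_subset_right

theorem part_biUnion [Fintype G.ConnectedComponent] {f : G.ConnectedComponent → Finset V}
    (hf : ∀ C, (f C : Set V) ⊆ C.supp) (C : G.ConnectedComponent) :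
    part C (univ.biUnion f) = f C := by
  ext v
  rw [mem_part, mem_biUnion]
  constructor
  · rintro ⟨⟨D, -, hv⟩, hvC⟩
    exact SimpleGraph.ConnectedComponent.eq_of_common_vertex hvC (hf D hv) ▸ hv
  · exact fun hv => ⟨⟨C, mem_univ C, hv⟩, hf C hv⟩

theorem isMaximumIndepSet_biUnion [Finite V] [Fintype G.ConnectedComponent]
    {f : G.ConnectedComponent → Finset V}
    (hf : ∀ C, IsMaximumIndepSetIn G C.supp (f C)) : G.IsMaximumIndepSet (univ.biUnion f) :=
  isMaximumIndepSet_iff_forall_part.2 fun C => by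
    rw [part_biUnion fun D => (hf D).subset]
    exact hf C

theorem exists_isMaximumIndepSet_part_eq [Finite V] (hS : IsMaximumIndepSetIn G C.supp S) :
    ∃ M : Finset V, G.IsMaximumIndepSet M ∧ part C M = S := by
  obtain ⟨M₀, hM₀⟩ := G.maximumIndepSet_exists
  have := Fintype.ofFinite G.ConnectedComponent
  let f := Function.update (part · M₀) C S
  have hf : ∀ D, IsMaximumIndepSetIn G D.supp (f D) := by
    refine (Function.forall_update_iff _
      fun (D : G.ConnectedComponent) T => IsMaximumIndepSetIn G D.supp T).2 ⟨hS, ?_⟩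
    exact fun D _ => isMaximumIndepSetIn_part hM₀ D
  refine ⟨univ.biUnion f, isMaximumIndepSet_biUnion hf, ?_⟩
  rw [part_biUnion fun D => (hf D).subset]
  exact Function.update_self ..

theorem prod_sum_isMaximumIndepSetIn [Fintype V] [Fintype G.ConnectedComponent]
    {R : Type*} [CommSemiring R] (g : G.ConnectedComponent → Finset V → R) :
    ∏ C : G.ConnectedComponent, ∑ S with IsMaximumIndepSetIn G C.supp S, g C S =
      ∑ M : {M : Finset V // G.IsMaximumIndepSet M}, ∏ C, g C (part C M.1) := by
  rw [prod_univ_sum]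
  have hf : ∀ {f}, f ∈ Fintype.piFinset (fun C : G.ConnectedComponent =>
      univ.filter (IsMaximumIndepSetIn G C.supp)) ↔
        ∀ C, IsMaximumIndepSetIn G C.supp (f C) := by
    simp
  have hpart : ∀ {f}, (∀ C : G.ConnectedComponent, IsMaximumIndepSetIn G C.supp (f C)) →
      ∀ C, part C (univ.biUnion f) = f C := fun hf => part_biUnion fun C => (hf C).subset
  refine sum_bij' (fun f hf' => ⟨univ.biUnion f, isMaximumIndepSet_biUnion (hf.1 hf')⟩)
    (fun M _ C => part C M.1) (fun _ _ => mem_univ _)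
    (fun M _ => hf.2 (isMaximumIndepSetIn_part M.2)) ?_ ?_ ?_
  · exact fun f hf' => funext (hpart (hf.1 hf'))
  · exact fun M _ => Subtype.ext (ext_of_part_eq (hpart (isMaximumIndepSetIn_part M.2)))
  · exact fun f hf' => prod_congr rfl fun C _ => by rw [hpart (hf.1 hf')]

end GraphComponents

section ComponentFamilies

variable {n : ℕ} {P : PartialOrder (Fin n)} {C : (idealGraph P).ConnectedComponent}
  {S : Finset (ConnIdeal P)}

theorem compMaxIndep_eq_filter (C : (idealGraph P).ConnectedComponent) :
    compMaxIndep C = univ.filter (IsMaximumIndepSetIn (idealGraph P) C.supp) := by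
  ext S
  simp only [compMaxIndep, mem_image, mem_filter, mem_univ, true_and]
  refine ⟨fun ⟨T, hT, hTS⟩ => hTS ▸ isMaximumIndepSet_toSimpleGraph_iff.1 hT, fun hS => ?_⟩
  have hmap : (S.subtype (· ∈ C)).map (Function.Embedding.subtype _) = S :=
    subtype_map_of_mem fun J hJ => hS.subset hJ
  exact ⟨S.subtype (· ∈ C), isMaximumIndepSet_toSimpleGraph_iff.2 (hmap.symm ▸ hS), hmap⟩

end ComponentFamilies

section ComponentIdeals

variable {n : ℕ} {P : PartialOrder (Fin n)} {C : (idealGraph P).ConnectedComponent}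
  {A J K : ConnIdeal P}

theorem not_adj_of_notMem_supp (hJ : J ∈ C.supp) (hA : A ∉ C.supp) : ¬(idealGraph P).Adj J A :=
  fun h => hA (C.mem_supp_of_adj_mem_supp hJ h)

theorem isConnIdeal_biUnion_supp (C : (idealGraph P).ConnectedComponent) :
    IsConnIdeal P ((univ.filter (· ∈ C.supp)).biUnion Subtype.val) := by
  set U := (univ.filter (· ∈ C.supp)).biUnion Subtype.val
  have hsub : ∀ {J}, J ∈ C.supp → J.1 ⊆ U := fun hJ =>
    subset_biUnion_of_mem Subtype.val (mem_filter.2 ⟨mem_univ _, hJ⟩)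
  have hmem : ∀ {x}, x ∈ U → ∃ J ∈ C.supp, x ∈ J.1 := fun hx => by
    simpa only [U, mem_biUnion, mem_filter, mem_univ, true_and] using hx
  refine isConnIdeal_iff.2 ⟨?_, isOrderIdeal_biUnion _, fun A hA ⟨x, hx⟩ => ?_⟩
  · obtain ⟨J, hJ⟩ := C.nonempty_supp
    exact J.2.nonempty.mono (hsub hJ)
  · obtain ⟨J, hJ, hxJ⟩ := hmem (hA.subset hx)
    have habsorb : ∀ L ∈ C.supp, (L.1 ∩ A).Nonempty → L.1 ⊆ A := fun L hL hne =>
      L.2.subset_of_isSummand hA (hsub hL) hne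
    have hall : C.supp ⊆ {L | L.1 ⊆ A} := by
      refine supp_subset_of_adj_closed hJ (habsorb J hJ ⟨x, mem_inter.2 ⟨hxJ, hx⟩⟩) ?_
      intro K hK L hadj hKA
      refine habsorb L (C.mem_supp_of_adj_mem_supp hK hadj) ?_
      exact (inter_comm K.1 L.1 ▸ hadj.1).mono (inter_subset_inter_left hKA)
    refine hA.subset.antisymm fun y hy => ?_
    obtain ⟨L, hL, hyL⟩ := hmem hy
    exact hall hL hyL

/-- The union of all members of the component `C` of `G_P`. It is a connected order ideal, but it
need not belong to `C`. -/
noncomputable def componentIdeal (C : (idealGraph P).ConnectedComponent) : ConnIdeal P :=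
  ⟨_, isConnIdeal_biUnion_supp C⟩

theorem mem_componentIdeal {i : Fin n} : i ∈ (componentIdeal C).1 ↔ ∃ J ∈ C.supp, i ∈ J.1 := by
  simp only [componentIdeal, mem_biUnion, mem_filter, mem_univ, true_and]

theorem le_componentIdeal (hJ : J ∈ C.supp) : J ≤ componentIdeal C := fun _ hi =>
  mem_componentIdeal.2 ⟨J, hJ, hi⟩

theorem componentIdeal_le (hJ : J ∈ C.supp) (hA : A ∉ C.supp) (hJA : J ≤ A) :
    componentIdeal C ≤ A := by
  have hall : C.supp ⊆ {K | K ≤ A} := by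
    refine supp_subset_of_adj_closed hJ hJA fun K hK L hadj hKA => ?_
    obtain ⟨i, hi⟩ := hadj.1
    obtain ⟨hiK, hiL⟩ := mem_inter.1 hi
    have hL := C.mem_supp_of_adj_mem_supp hK hadj
    refine (le_or_le_of_not_adj (not_adj_of_notMem_supp hL hA) hiL (hKA hiK)).resolve_right ?_
    exact fun hAL => hadj.2.1 (hKA.trans hAL)
  intro i hi
  obtain ⟨K, hK, hiK⟩ := mem_componentIdeal.1 hi
  exact hall hK hiK

theorem isIsolated_componentIdeal (C : (idealGraph P).ConnectedComponent) :
    (idealGraph P).IsIsolated (componentIdeal C) := by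
  refine fun A => idealGraph_not_adj_iff.2 (or_iff_not_imp_left.2 fun hmeet => ?_)
  by_cases hA : A ∈ C.supp
  · exact .inr (le_componentIdeal hA)
  obtain ⟨i, hiC, hiA⟩ := not_disjoint_iff.1 hmeet
  obtain ⟨J, hJ, hiJ⟩ := mem_componentIdeal.1 hiC
  exact (le_or_le_of_not_adj (not_adj_of_notMem_supp hJ hA) hiJ hiA).imp
    (componentIdeal_le hJ hA) fun hAJ => hAJ.trans (le_componentIdeal hJ)

theorem componentIdeal_mem (M : MaxIndep P) (C : (idealGraph P).ConnectedComponent) :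
    componentIdeal C ∈ M.1 :=
  mem_of_isIsolated M.2 (isIsolated_componentIdeal C)

theorem componentIdeal_mem_supp_of_isIsolated (hJ : J ∈ C.supp)
    (hiso : (idealGraph P).IsIsolated J) : componentIdeal C ∈ C.supp := by
  suffices componentIdeal C = J from this ▸ hJ
  refine le_antisymm (fun i hi => ?_) (le_componentIdeal hJ)
  obtain ⟨K, hK, hiK⟩ := mem_componentIdeal.1 hi
  exact supp_subset_singleton_of_isIsolated hJ hiso hK ▸ hiK

theorem lt_componentIdeal (hC : componentIdeal C ∉ C.supp) (hJ : J ∈ C.supp) :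
    J < componentIdeal C :=
  (le_componentIdeal hJ).lt_of_ne fun h => hC (h ▸ hJ)

theorem componentIdeal_mk_lt (hC : componentIdeal C ∉ C.supp) (hJ : J ∈ C.supp)
    (hK : K ∉ C.supp) (hKJ : K < J) :
    componentIdeal ((idealGraph P).connectedComponentMk K) < J := by
  have hJK : J ∉ ((idealGraph P).connectedComponentMk K).supp := fun h =>
    hK (SimpleGraph.ConnectedComponent.eq_of_common_vertex h hJ ▸ rfl)
  refine (componentIdeal_le rfl hJK hKJ.le).lt_of_ne fun h => hC ?_
  exact componentIdeal_mem_supp_of_isIsolated hJ (h ▸ isIsolated_componentIdeal _)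

theorem componentIdeal_mk_lt_componentIdeal (hC : componentIdeal C ∉ C.supp) (hK : K ∉ C.supp)
    (hKC : K < componentIdeal C) :
    componentIdeal ((idealGraph P).connectedComponentMk K) < componentIdeal C := by
  obtain ⟨i, hi⟩ := K.2.nonempty
  obtain ⟨J, hJ, hiJ⟩ := mem_componentIdeal.1 (hKC.le hi)
  have hKJ : K ≤ J := (le_or_le_of_not_adj (not_adj_of_notMem_supp hJ hK) hiJ hi).resolve_left
    fun hJK => hKC.not_ge (componentIdeal_le hJ hK hJK)
  exact (componentIdeal_mk_lt hC hJ hK (hKJ.lt_of_ne fun h => hK (h ▸ hJ))).trans_le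
    (le_componentIdeal hJ)

end ComponentIdeals

section Locality

variable {n : ℕ} {P : PartialOrder (Fin n)} {C : (idealGraph P).ConnectedComponent}
  {J : ConnIdeal P} {M M' : MaxIndep P} {Mr : Finset (ConnIdeal P)} {i j : Fin n}

theorem exists_mem_le_of_isLeast (hK : IsLeast {L ∈ M.1 | node M i < L} (node M j)) :
    ∃ x ∈ (node M i).1, P.le x j := by
  obtain ⟨⟨-, hlt⟩, hmin⟩ := hK
  by_contra! hnone
  have hsummand : IsSummand P (node M i).1 (node M j).1 := by
    refine ⟨hlt.le, (node M i).2.isOrderIdeal, fun y x hxy hy => ?_⟩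
    obtain ⟨hyK, hyJ⟩ := mem_sdiff.1 hy
    refine mem_sdiff.2 ⟨(node M j).2.isOrderIdeal hxy hyK, fun hxJ => ?_⟩
    have hymu : y ∈ mu M.1 (node M j) := by
      by_contra h
      have hyj : y ∈ ({j} : Finset (Fin n)) := node_sdiff_mu M j ▸ mem_sdiff.2 ⟨hyK, h⟩
      exact hnone x hxJ (mem_singleton.1 hyj ▸ hxy)
    obtain ⟨L, hL, hLK, hyL⟩ := mem_mu.1 hymu
    have hLJ : ¬L ≤ node M i := fun h => hyJ (h hyL)
    have hJL : node M i ≤ L := (le_or_le_of_mem M.2.isIndepSet (node_mem M i) hL hxJ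
      (L.2.isOrderIdeal hxy hyL)).resolve_right hLJ
    exact hLK.not_ge (hmin ⟨hL, hJL.lt_of_not_ge hLJ⟩)
  have hJK := (isConnIdeal_iff.1 (node M j).2).2.2 _ hsummand (node M i).2.nonempty
  exact hlt.ne (Subtype.ext hJK)

theorem notMem_des_of_isIsolated (hP : NaturallyLabeled P)
    (hiso : (idealGraph P).IsIsolated (node M i)) : i ∉ des M := by
  intro hdes
  obtain ⟨j, hK, hji⟩ := mem_des_iff.1 hdes
  obtain ⟨x, hxJ, hxj⟩ := exists_mem_le_of_isLeast hK
  let Q : ConnIdeal P := ⟨_, isConnIdeal_principal P j⟩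
  have hmemQ : ∀ {y}, y ∈ Q.1 ↔ P.le y j := by simp [Q]
  obtain hJQ | hQJ := le_or_le_of_not_adj (hiso Q) hxJ (hmemQ.2 hxj)
  · have hij : i ≠ j := fun h => hK.1.2.ne (congrArg (node M) h)
    have hlt : P.lt i j := @lt_of_le_of_ne _ P _ _ (hmemQ.1 (hJQ (self_mem_node M i))) hij
    exact (hP i j hlt).not_gt hji
  · exact hK.1.2.not_ge ((node_le_iff (node_mem M i)).2 (hQJ (hmemQ.2 (P.le_refl j))))

theorem mem_iff_of_part_eq (hpart : part C M.1 = part C M'.1) (hJ : J ∈ C.supp) :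
    J ∈ M.1 ↔ J ∈ M'.1 := by
  simpa only [mem_part, hJ, and_true] using (congrArg (J ∈ ·) hpart).to_iff

/- If `K ∈ M` is not in `C`, then the ideal of the component of `K` belongs to `M'` as well, and it
can replace `K` in the union that defines `μ`. -/
theorem mu_subset_of_part_eq (hpart : part C M.1 = part C M'.1) (hC : componentIdeal C ∉ C.supp)
    (hJ : J ∈ C.supp ∨ J = componentIdeal C) : mu M.1 J ⊆ mu M'.1 J := by
  intro i hi
  obtain ⟨K, hK, hKJ, hiK⟩ := mem_mu.1 hi
  by_cases hKC : K ∈ C.supp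
  · exact mem_mu.2 ⟨K, (mem_iff_of_part_eq hpart hKC).1 hK, hKJ, hiK⟩
  refine mem_mu.2 ⟨_, componentIdeal_mem M' _, ?_, le_componentIdeal rfl hiK⟩
  obtain hJ | rfl := hJ
  · exact componentIdeal_mk_lt hC hJ hKC hKJ
  · exact componentIdeal_mk_lt_componentIdeal hC hKC hKJ

theorem node_eq_of_part_eq (hpart : part C M.1 = part C M'.1) (hC : componentIdeal C ∉ C.supp)
    (hi : node M i ∈ C.supp ∨ node M i = componentIdeal C) : node M' i = node M i := by
  have hmem : node M i ∈ M'.1 := by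
    obtain h | h := hi
    · exact (mem_iff_of_part_eq hpart h).1 (node_mem M i)
    · exact h ▸ componentIdeal_mem M' C
  refine node_eq_of_mem_sdiff_mu hmem ?_
  exact sdiff_subset_sdiff Subset.rfl (mu_subset_of_part_eq hpart.symm hC hi)
    (mem_node_sdiff_mu M i)

theorem mem_supp_or_eq_componentIdeal_of_isLeast (hC : componentIdeal C ∉ C.supp)
    (hJ : J ∈ C.supp) {K : ConnIdeal P} (hK : IsLeast {L ∈ M.1 | J < L} K) :
    K ∈ C.supp ∨ K = componentIdeal C :=
  or_iff_not_imp_left.2 fun hKC =>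
    (hK.2 ⟨componentIdeal_mem M C, lt_componentIdeal hC hJ⟩).antisymm
      (componentIdeal_le hJ hKC hK.1.2.le)

theorem componentIdeal_notMem_supp_of_mem_des (hP : NaturallyLabeled P)
    (hi : node M i ∈ C.supp) (hdes : i ∈ des M) : componentIdeal C ∉ C.supp := by
  intro hC
  have hnode : node M i = componentIdeal C :=
    supp_subset_singleton_of_isIsolated hC (isIsolated_componentIdeal C) hi
  exact notMem_des_of_isIsolated hP (hnode ▸ isIsolated_componentIdeal C) hdes

theorem mem_des_of_part_eq (hpart : part C M.1 = part C M'.1) (hC : componentIdeal C ∉ C.supp)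
    (hi : node M i ∈ C.supp) (hdes : i ∈ des M) : i ∈ des M' := by
  obtain ⟨j, hK, hji⟩ := mem_des_iff.1 hdes
  have hj := mem_supp_or_eq_componentIdeal_of_isLeast hC hi hK
  have hnode := node_eq_of_part_eq hpart hC hj
  refine mem_des_iff.2 ⟨j, ?_, hji⟩
  rw [node_eq_of_part_eq hpart hC (.inl hi)]
  refine ⟨⟨node_mem M' j, hnode ▸ hK.1.2⟩, fun L ⟨hL, hlt⟩ => hnode ▸ ?_⟩
  by_cases hLC : L ∈ C.supp
  · exact hK.2 ⟨(mem_iff_of_part_eq hpart hLC).2 hL, hlt⟩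
  · exact (hj.elim le_componentIdeal le_of_eq).trans (componentIdeal_le hi hLC hlt.le)

theorem desBarIn_subset_of_part_eq (hP : NaturallyLabeled P) (hM : part C M.1 = Mr)
    (hM' : part C M'.1 = Mr) : desBarIn Mr M ⊆ desBarIn Mr M' := by
  intro J hJ
  have hJMr : J ∈ Mr := desBarIn_subset Mr M hJ
  obtain ⟨hJM, hJC⟩ := mem_part.1 (hM ▸ hJMr)
  obtain ⟨i, rfl⟩ := exists_node_eq hJM
  have hdes := (node_mem_desBarIn_iff.1 hJ).2
  have hpart : part C M.1 = part C M'.1 := hM.trans hM'.symm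
  have hC := componentIdeal_notMem_supp_of_mem_des hP hJC hdes
  have hnode := node_eq_of_part_eq hpart hC (.inl hJC)
  rw [← hnode] at hJMr ⊢
  exact node_mem_desBarIn_iff.2 ⟨hJMr, mem_des_of_part_eq hpart hC hJC hdes⟩

theorem desBarIn_eq_desBar (hP : NaturallyLabeled P) (hM : part C M.1 = Mr) :
    desBarIn Mr M = desBar C Mr := by
  have hex : ∃ M : MaxIndep P, (M.1 : Set (ConnIdeal P)) ∩ C.supp = Mr :=
    ⟨M, inter_supp_eq_iff.2 hM⟩
  have hchoose := inter_supp_eq_iff.1 hex.choose_spec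
  rw [desBar, dif_pos hex]
  exact (desBarIn_subset_of_part_eq hP hM hchoose).antisymm
    (desBarIn_subset_of_part_eq hP hchoose hM)

theorem desBarIn_part (M : MaxIndep P) (C : (idealGraph P).ConnectedComponent) :
    desBarIn (part C M.1) M = part C (desBarIn M.1 M) := by
  have hiff : ∀ J ∈ M.1, J ∈ desBarIn (part C M.1) M ↔ J ∈ part C (desBarIn M.1 M) := by
    intro J hJ
    obtain ⟨i, rfl⟩ := exists_node_eq hJ
    rw [mem_part, node_mem_desBarIn_iff, node_mem_desBarIn_iff, mem_part, and_right_comm]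
  ext J
  by_cases hJ : J ∈ M.1
  · exact hiff J hJ
  · exact iff_of_false (fun h => hJ (mem_part.1 (desBarIn_subset _ M h)).1)
      fun h => hJ (desBarIn_subset _ M (mem_part.1 h).1)

theorem desBar_part (hP : NaturallyLabeled P) (M : MaxIndep P)
    (C : (idealGraph P).ConnectedComponent) :
    desBar C (part C M.1) = part C (desBarIn M.1 M) := by
  rw [← desBarIn_eq_desBar hP rfl, desBarIn_part]

theorem exists_maxIndep_inter_supp_eq (hMr : Mr ∈ compMaxIndep C) :
    ∃ M : MaxIndep P, (M.1 : Set (ConnIdeal P)) ∩ C.supp = Mr := by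
  rw [compMaxIndep_eq_filter, mem_filter] at hMr
  obtain ⟨M, hM, hpart⟩ := exists_isMaximumIndepSet_part_eq hMr.2
  exact ⟨⟨M, hM⟩, inter_supp_eq_iff.2 hpart⟩

theorem prod_sum_compMaxIndep {R : Type*} [CommSemiring R]
    (g : (idealGraph P).ConnectedComponent → Finset (ConnIdeal P) → R) :
    ∏ C, ∑ Mr ∈ compMaxIndep C, g C Mr = ∑ M : MaxIndep P, ∏ C, g C (part C M.1) := by
  simp only [compMaxIndep_eq_filter]
  exact prod_sum_isMaximumIndepSetIn g

end Locality

end ConnectedOrderIdeals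

theorem mainTheorem5 (n : ℕ) (P : PartialOrder (Fin n))
    (hP : ConnectedOrderIdeals.NaturallyLabeled P) :
    (∀ C : (ConnectedOrderIdeals.idealGraph P).ConnectedComponent,
      ∀ Mr ∈ ConnectedOrderIdeals.compMaxIndep C,
        (∃ M : ConnectedOrderIdeals.MaxIndep P,
          (M.1 : Set (ConnectedOrderIdeals.ConnIdeal P)) ∩ C.supp =
            (Mr : Set (ConnectedOrderIdeals.ConnIdeal P))) ∧
        ∀ M : ConnectedOrderIdeals.MaxIndep P,
          (M.1 : Set (ConnectedOrderIdeals.ConnIdeal P)) ∩ C.supp =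
            (Mr : Set (ConnectedOrderIdeals.ConnIdeal P)) →
          ConnectedOrderIdeals.desBarIn Mr M = ConnectedOrderIdeals.desBar C Mr) ∧
    ∑ w ∈ ConnectedOrderIdeals.linearExtensions P,
        ConnectedOrderIdeals.q ^ ConnectedOrderIdeals.maj w =
      ConnectedOrderIdeals.qFactorial n *
        ∏ C : (ConnectedOrderIdeals.idealGraph P).ConnectedComponent,
          ∑ Mr ∈ ConnectedOrderIdeals.compMaxIndep C,
            ConnectedOrderIdeals.q ^ (∑ J ∈ ConnectedOrderIdeals.desBar C Mr, J.1.card) /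
              ∏ J ∈ Mr, ConnectedOrderIdeals.qBracket J.1.card := by
  open ConnectedOrderIdeals in
  refine ⟨fun C Mr hMr => ⟨exists_maxIndep_inter_supp_eq hMr, fun M hM => ?_⟩, ?_⟩
  · exact desBarIn_eq_desBar hP (inter_supp_eq_iff.1 hM)
  rw [sum_linearExtensions hP, indepSum_univ hP, prod_sum_compMaxIndep]
  congr 1
  refine Finset.sum_congr rfl fun M _ => ?_
  rw [Finset.prod_div_distrib, prod_part, ← prod_part (G := idealGraph P) (desBarIn M.1 M)]
  simp only [desBar_part hP, Finset.prod_pow_eq_pow_sum]
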